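/- For a set $A$ let $F_A$ be the free group on $A$ and $F_A'$ its derived subgroup. The pro-abelian topology on a group is the coarsest topology making all homomorphisms to finite discrete abelian groups continuous; for $H\le F_A$ let $\mathrm{Cl}_{\mathbf{Ab}}(H)$ be the closure of $H$ in this topology of $F_A$, and call $H$ $\mathbf{Ab}$-closed (resp. $\mathbf{Ab}$-dense) if it is closed (resp. dense) in it. **Theorem.** Let $H\le F_A$ be a finitely generated subgroup. Then: 1. $\mathrm{Cl}_{\mathbf{Ab}}(H)=HF_A'$. 2. If $A$ is infinite, then $\mathrm{Cl}_{\mathbf{Ab}}(H)$ is not finitely generated. 3. If $A$ is finite, and not both $|A|=1$ and $H=1$, then $\mathrm{Cl}_{\mathbf{Ab}}(H)$ is finitely generated if and only if it has finite index in $F_A$. 4. It is decidable whether or not $\mathrm{Cl}_{\mathbf{Ab}}(H)$ is finitely generated. 5. If $\mathrm{Cl}_{\mathbf{Ab}}(H)$ is finitely generated, a (finite) basis of $\mathrm{Cl}_{\mathbf{Ab}}(H)$ can be computed. 6. It is decidable whether or not $H$ is $\mathbf{Ab}$-closed. 7. It is decidable whether or not $H$ is $\mathbf{Ab}$-dense.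 8. The membership problem for $\mathrm{Cl}_{\mathbf{Ab}}(H)$ is decidable. 9. If $A$ is finite, there are a recursively enumerable basis $B$ of $\mathrm{Cl}_{\mathbf{Ab}}(H)$ and an algorithm which expresses any element of $\mathrm{Cl}_{\mathbf{Ab}}(H)$ as a word on $B$. In 4–9 the algorithms are uniform: the input consists of the size of $A$ (a natural number $n$, or the information that $A$ is infinite), a finite list of words over $A\cup A^{-1}$ generating $H$ and, in 8 and in the second part of 9, a further word representing the element in question. The letters are named by natural numbers: the letters of $A$ are named bijectively by $0,\dots,n-1$ if $|A|=n$, and distinct letters occurring in the input have distinct names if $A$ is infinite. -/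

import Mathlib

open scoped Pointwise

universe u

namespace ProAb

/-! ### The pro-abelian topology -/

/-- The pro-**Ab** topology on a group `G`: the coarsest topology for which every homomorphism from
`G` to a finite abelian group, taken with the discrete topology `⊥`, is continuous. (Every finite
abelian group has an isomorphic copy in `Type`.) -/
@[reducible] def proAbTopology (G : Type u) [Group G] : TopologicalSpace G :=
  ⨅ (Q : Type) (_ : CommGroup Q) (_ : Finite Q) (φ : G →* Q), TopologicalSpace.induced φ ⊥

theorem isTopologicalGroup_proAb (G : Type u) [Group G] :
    @IsTopologicalGroup G (proAbTopology G) _ := by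
  unfold proAbTopology
  refine topologicalGroup_iInf fun Q => topologicalGroup_iInf fun _ =>
    topologicalGroup_iInf fun _ => topologicalGroup_iInf fun φ => ?_
  let _ : TopologicalSpace Q := ⊥
  have : DiscreteTopology Q := ⟨rfl⟩
  exact topologicalGroup_induced φ

/-- `Cl_Ab(H)`: the closure of the subgroup `H` in the pro-**Ab** topology, as a subgroup. -/
def clAb {G : Type u} [Group G] (H : Subgroup G) : Subgroup G :=
  @Subgroup.topologicalClosure G (proAbTopology G) _ (isTopologicalGroup_proAb G) H

/-- `H` is **Ab**-closed. -/
def IsAbClosed {G : Type u} [Group G] (H : Subgroup G) : Prop :=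
  @IsClosed G (proAbTopology G) (H : Set G)

/-- `H` is **Ab**-dense. -/
def IsAbDense {G : Type u} [Group G] (H : Subgroup G) : Prop :=
  @Dense G (proAbTopology G) (H : Set G)

/-- The family `v` of elements of `G` is a basis of (i.e. freely generates) the subgroup `K`. -/
def IsBasisOf {G : Type u} [Group G] {ι : Type*} (v : ι → G) (K : Subgroup G) : Prop :=
  ∃ b : FreeGroupBasis ι K, ∀ i, (b i : G) = v i

/-! ### Finitely generated subgroups as inputs of algorithms

A word over `A` is a list of pairs `(a, ε)`, standing for `a` if `ε = true` and for `a⁻¹` if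
`ε = false`; it need not be reduced. It represents the element `FreeGroup.mk w` of `F_A`. -/

/-- Words over the alphabet `A ∪ A⁻¹`. -/
abbrev Word (A : Type u) : Type u := List (A × Bool)

/-- The subgroup of `F_A` generated by a finite list of words. -/
def gen {A : Type u} (W : List (Word A)) : Subgroup (FreeGroup A) :=
  Subgroup.closure {g | ∃ w ∈ W, FreeGroup.mk w = g}

/-- The letters that occur in a list of words. -/
def letters {A : Type u} (W : List (Word A)) : Set A :=
  {a | ∃ w ∈ W, ∃ ε, (a, ε) ∈ w}

/-- What a machine is told about the alphabet: `some n` if `A` has exactly `n` elements, `none` if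
`A` is infinite. -/
noncomputable def alphabetSize (A : Type u) : Option ℕ :=
  open Classical in if Finite A then some (Nat.card A) else none

/-- `ν` names letters of `A` by natural numbers. A finite alphabet with `n` letters is numbered
bijectively by `0, …, n - 1`; in an infinite (possibly uncountable) alphabet, distinct letters
from the relevant set `S` (those which occur in the input) receive distinct numbers. -/
structure IsNumbering {A : Type u} (ν : A → ℕ) (S : Set A) : Prop where
  injOn : Set.InjOn ν S
  injective_of_finite : Finite A → Function.Injective ν
  lt_card_of_finite : Finite A → ∀ a, ν a < Nat.card A

/-- The word of named letters which the machine reads or prints for a word over `A`. -/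
def codeWord {A : Type u} (ν : A → ℕ) (w : Word A) : Word ℕ :=
  w.map (Prod.map ν id)

/-- Inputs of the algorithms: the size of the alphabet and a finite list of (generating) words. -/
abbrev Input : Type := Option ℕ × List (Word ℕ)

/-- The input which represents the free group `F_A` and its subgroup `gen W`. -/
noncomputable def input {A : Type u} (ν : A → ℕ) (W : List (Word A)) : Input :=
  (alphabetSize A, W.map (codeWord ν))

/-- The property `Q` of finitely generated subgroups `H` of free groups `F_A` is decidable: a single
algorithm decides it, for all alphabets `A` and all `H`, when given the size of `A` and finitely
many words that generate `H`. -/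
def DecidableForFG (Q : (A : Type u) → Subgroup (FreeGroup A) → Prop) : Prop :=
  ∃ P : Input → Prop, ComputablePred P ∧
    ∀ (A : Type u) (ν : A → ℕ) (W : List (Word A)), IsNumbering ν (letters W) →
      (P (input ν W) ↔ Q A (gen W))

/-- The uniform membership problem for the subgroups `K H`, where `H` runs through the finitely
generated subgroups of free groups `F_A`, is decidable: a single algorithm decides, for given size
of `A`, words that generate `H` and a word `u`, whether `u` represents an element of `K H`. -/
def MembershipDecidableForFG
    (K : (A : Type u) → Subgroup (FreeGroup A) → Subgroup (FreeGroup A)) : Prop :=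
  ∃ P : Input × Word ℕ → Prop, ComputablePred P ∧
    ∀ (A : Type u) (ν : A → ℕ) (W : List (Word A)) (u : Word A),
      IsNumbering ν (letters (u :: W)) →
      (P (input ν W, codeWord ν u) ↔ FreeGroup.mk u ∈ K A (gen W))

/-- A finite basis of `K H` is computable from `H` whenever `K H` is finitely generated: a single
algorithm prints it, as a list of words, when given the size of `A` and words that generate `H`. -/
def BasisComputableForFG
    (K : (A : Type u) → Subgroup (FreeGroup A) → Subgroup (FreeGroup A)) : Prop :=
  ∃ f : Input → List (Word ℕ), Computable f ∧
    ∀ (A : Type u) (ν : A → ℕ) (W : List (Word A)), IsNumbering ν (letters W) →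
      (K A (gen W)).FG →
      ∃ B : List (Word A), f (input ν W) = B.map (codeWord ν) ∧
        IsBasisOf (fun i : Fin B.length => FreeGroup.mk (B.get i)) (K A (gen W))

/-- For finite alphabets `A` and finitely generated `H ≤ F_A`, a recursively enumerable basis
of `K H` (a set of words, recursively enumerable uniformly in the input) and an algorithm which
expresses each element `u` of `K H` as a word on that basis. The algorithm prints a word `E`
whose letters are basis elements with exponents `±1`;
`FreeGroup.lift FreeGroup.mk (FreeGroup.mk E)` is the value of `E` in `F_A`. -/
def REBasisForFG
    (K : (A : Type u) → Subgroup (FreeGroup A) → Subgroup (FreeGroup A)) : Prop :=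
  ∃ (B : Input → Set (Word ℕ)) (expr : Input × Word ℕ → List (Word ℕ × Bool)),
    REPred (fun p : Input × Word ℕ => p.2 ∈ B p.1) ∧ Computable expr ∧
    ∀ (A : Type u) [Finite A] (ν : A → ℕ) (W : List (Word A)), IsNumbering ν (letters W) →
      ∃ S : Set (Word A), B (input ν W) = codeWord ν '' S ∧
        IsBasisOf (fun w : S => FreeGroup.mk (w : Word A)) (K A (gen W)) ∧
        ∀ u : Word A, FreeGroup.mk u ∈ K A (gen W) →
          ∃ E : List (Word A × Bool),
            expr (input ν W, codeWord ν u) = E.map (Prod.map (codeWord ν) id) ∧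
            (∀ p ∈ E, p.1 ∈ S) ∧
            FreeGroup.lift (fun w : Word A => FreeGroup.mk w) (FreeGroup.mk E) = FreeGroup.mk u

end ProAb

/-! Write `F` for the free group. Homomorphisms to abelian groups kill `F'`, so the closure of `H`
contains `HF'`. Conversely, a nontrivial element of the abelian group `F/HF'` is detected by a
character to `ℚ/ℤ`. Only finitely many letters occur in the generators of `H` and in a word for that
element, so lifting the character to `ℚ` and clearing denominators gives integral weights `z` and a
modulus `m` such that `wt z` modulo `m` kills `H` but not the element (`exists_wt_not_dvd`,
`clAb_gen`).

If `A` is infinite, a finitely generated subgroup misses two letters, hence also their commutator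
(`not_fg_of_commutator_le`). If `A` is finite and `HF'` has infinite index, some letter `a` has
infinite order modulo `HF'`, and some `wt z` kills `HF'` but not `a` (`exists_wt_eq_zero`). Let each
letter `c` act on `ℚ` with slope `2 ^ z c`, a second letter `b` translating by `1` in addition. Then
`HF'` acts by translations. Finite generation would bound their denominators, but conjugating `⁅a,
b⁆` by powers of `a` makes them arbitrarily large (`not_fg_of_le_ker_wt`). Without a second letter,
`F` is infinite cyclic and `H` is trivial, which is the exception.

The decision procedures rest on Post's theorem: membership in `H`, membership in `HF'` and torsion
of `F/HF'` have checkable finite certificates, and so do their negations. Closedness means `F' ≤ H`,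
which amounts to finitely many memberships (`commutator_le_gen_iff`); density means that all letters
lie in `HF'`.

For the bases, the words of least code in the cosets of `HF'` form a computable Schreier transversal
(`isSchreierRep_of_codeWord`). Its nontrivial Schreier generators are a basis
(`IsSchreierRep.isBasisOf`), and the rewriting process expresses elements in it. If `HF'` is
finitely generated, a search finds a finite part of this basis that generates, and such a part is
the whole basis (`mem_of_isBasisOf`). -/

section ComputabilityToolkit

/-! ### Computable functions and predicates: lists, searches, certificates -/

open Encodable

variable {α β σ : Type*} [Primcodable α] [Primcodable β] [Primcodable σ]

theorem ComputablePred.comp {p : β → Prop} {f : α → β} (hp : ComputablePred p)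
    (hf : Computable f) : ComputablePred fun a => p (f a) := by
  obtain ⟨_, h⟩ := hp
  exact ⟨fun a => inferInstance, h.comp hf⟩

theorem ComputablePred.and {p q : α → Prop} (hp : ComputablePred p) (hq : ComputablePred q) :
    ComputablePred fun a => p a ∧ q a := by
  obtain ⟨_, hp⟩ := hp
  obtain ⟨_, hq⟩ := hq
  exact ⟨fun a => inferInstance,
    (Primrec.and.to_comp.comp hp hq).of_eq fun a => by simp⟩

theorem ComputablePred.or {p q : α → Prop} (hp : ComputablePred p) (hq : ComputablePred q) :
    ComputablePred fun a => p a ∨ q a := by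
  obtain ⟨_, hp⟩ := hp
  obtain ⟨_, hq⟩ := hq
  exact ⟨fun a => inferInstance,
    (Primrec.or.to_comp.comp hp hq).of_eq fun a => by simp⟩

theorem ComputablePred.imp {p q : α → Prop} (hp : ComputablePred p) (hq : ComputablePred q) :
    ComputablePred fun a => p a → q a := by
  classical
  exact (hp.not.or hq).of_eq fun a => by tauto

theorem ComputablePred.eq {f g : α → β} (hf : Computable f) (hg : Computable g) :
    ComputablePred fun a => f a = g a :=
  ComputablePred.comp (p := fun q : β × β => q.1 = q.2)
    (PrimrecPred.computablePred Primrec.eq) (hf.pair hg)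

theorem ComputablePred.lt {f g : α → ℕ} (hf : Computable f) (hg : Computable g) :
    ComputablePred fun a => f a < g a :=
  ComputablePred.comp (p := fun q : ℕ × ℕ => q.1 < q.2)
    (PrimrecPred.computablePred Primrec.nat_lt) (hf.pair hg)

theorem Computable.ite {p : α → Prop} [DecidablePred p] {f g : α → σ} (hp : ComputablePred p)
    (hf : Computable f) (hg : Computable g) : Computable fun a => if p a then f a else g a :=
  (Computable.cond hp.decide hf hg).of_eq fun a => by by_cases h : p a <;> simp [h]

/-- A right fold is recursion on the length that reads the reversed list by index; the value for a
missing entry is never used. The step may be any computable function, for instance one that calls an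
unbounded search. -/
theorem Computable.list_foldr {f : α → List β} {g : α → σ} {h : α → β × σ → σ}
    (hf : Computable f) (hg : Computable g) (hh : Computable₂ h) :
    Computable fun a => (f a).foldr (fun b s => h a (b, s)) (g a) := by
  have key : Computable fun a => Nat.rec (motive := fun _ => σ) (g a)
      (fun i s => Option.casesOn ((f a).reverse[i]?) s (fun b => h a (b, s))) (f a).length := by
    refine Computable.nat_rec (Computable.list_length.comp hf) hg
      (h := fun a p => Option.casesOn ((f a).reverse[p.1]?) p.2 (fun b => h a (b, p.2))) ?_
    refine Computable.option_casesOn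
      (o := fun q : α × ℕ × σ => (f q.1).reverse[q.2.1]?) (f := fun q => q.2.2)
      (g := fun q b => h q.1 (b, q.2.2)) ?_ (Computable.snd.comp Computable.snd) ?_
    · exact Computable.list_getElem?.comp (Computable.list_reverse.comp (hf.comp Computable.fst))
        (Computable.fst.comp Computable.snd)
    · exact hh.comp (Computable.fst.comp Computable.fst)
        (Computable.snd.pair (Computable.snd.comp (Computable.snd.comp Computable.fst)))
  refine key.of_eq fun a => ?_
  generalize f a = l
  have : ∀ n ≤ l.length, (Nat.rec (motive := fun _ => σ) (g a)
      (fun i s => Option.casesOn (l.reverse[i]?) s (fun b => h a (b, s))) n : σ) =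
      (l.reverse.take n).foldl (fun s b => h a (b, s)) (g a) := by
    intro n hn
    induction n with
    | zero => simp
    | succ n ih =>
      have hlt : n < l.reverse.length := by simpa using hn
      rw [List.take_succ_eq_append_getElem hlt, List.foldl_append, ← ih (by omega)]
      simp only [List.getElem?_eq_getElem hlt, List.foldl_cons, List.foldl_nil]
  rw [this _ le_rfl, ← List.length_reverse, List.take_length, List.foldl_reverse]

theorem ComputablePred.forall_mem_list {p : α → β → Prop} {f : α → List β}
    (hp : ComputablePred fun q : α × β => p q.1 q.2) (hf : Computable f) :
    ComputablePred fun a => ∀ b ∈ f a, p a b := by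
  classical
  have h : Computable fun a => (f a).foldr (fun b s => decide (p a b) && s) true :=
    Computable.list_foldr (h := fun a q => decide (p a q.1) && q.2) hf (Computable.const true)
      (Primrec.and.to_comp.comp
        (hp.decide.comp (Computable.fst.pair (Computable.fst.comp Computable.snd)))
        (Computable.snd.comp Computable.snd))
  refine ⟨fun a => inferInstance, h.of_eq fun a => ?_⟩
  beta_reduce
  generalize f a = l
  induction l with
  | nil => simp
  | cons b l ih => simp [ih]

theorem ComputablePred.forall_lt {p : α → ℕ → Prop} {f : α → ℕ}
    (hp : ComputablePred fun q : α × ℕ => p q.1 q.2) (hf : Computable f) :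
    ComputablePred fun a => ∀ i < f a, p a i :=
  (ComputablePred.forall_mem_list hp (Primrec.list_range.to_comp.comp hf)).of_eq
    fun a => by simp

theorem Computable.list_map {f : α → List β} {g : α → β → σ} (hf : Computable f)
    (hg : Computable₂ g) : Computable fun a => (f a).map (g a) := by
  refine (Computable.list_foldr (h := fun a q => g a q.1 :: q.2) hf (Computable.const [])
    (Computable.list_cons.comp
      (hg.comp Computable.fst (Computable.fst.comp Computable.snd))
      (Computable.snd.comp Computable.snd))).of_eq fun a => ?_
  generalize f a = l
  induction l with
  | nil => rfl
  | cons b l ih => simp [ih]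

theorem Computable.list_flatMap {f : α → List β} {g : α → β → List σ} (hf : Computable f)
    (hg : Computable₂ g) : Computable fun a => (f a).flatMap (g a) :=
  (Primrec.list_flatten.to_comp.comp (Computable.list_map hf hg)).of_eq fun a => by
    simp [List.flatMap]

/-- A total unbounded search: the value found has the least code. -/
theorem ComputablePred.exists_computable_choice {R : α → β → Prop}
    (hR : ComputablePred fun q : α × β => R q.1 q.2) (hex : ∀ a, ∃ b, R a b) :
    ∃ f : α → β, Computable f ∧ ∀ a, R a (f a) ∧ ∀ b, R a b → encode (f a) ≤ encode b := by
  classical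
  have hP : ∀ a, ∃ n, ∃ b, R a b ∧ encode b = n := fun a => by
    obtain ⟨b, hb⟩ := hex a
    exact ⟨_, b, hb, rfl⟩
  have hfind : ∀ a, ∃ b, R a b ∧ encode b = Nat.find (hP a) := fun a => Nat.find_spec (hP a)
  choose f hf1 hf2 using hfind
  refine ⟨f, ?_, fun a => ⟨hf1 a, fun b hb => ?_⟩⟩
  · rw [← Computable.encode_iff]
    -- `decode₂` yields `b` only at `n = encode b`, so the first success of the search is the least
    -- code of a witness.
    have hdec : Computable₂ fun (a : α) (n : ℕ) =>
        (Option.casesOn (decode₂ β n) false fun b => decide (R a b) : Bool) :=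
      Computable.option_casesOn (Primrec.decode₂.to_comp.comp Computable.snd)
        (Computable.const false)
        (hR.decide.comp ((Computable.fst.comp Computable.fst).pair Computable.snd)).to₂
    refine Partrec.of_eq_tot (Partrec.rfind hdec.partrec₂) fun a => ?_
    have hiff : ∀ n, (Option.casesOn (decode₂ β n) false fun b => decide (R a b) : Bool) = true ↔
        ∃ b, R a b ∧ encode b = n := by
      intro n
      rcases h : decode₂ β n with _ | b
      · simp only [Bool.false_eq_true, false_iff, not_exists, not_and]
        rintro b - hb
        have : b ∈ decode₂ β n := mem_decode₂.2 hb
        simp [h] at this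
      · have hb : encode b = n := mem_decode₂.1 h
        simp only [decide_eq_true_eq]
        refine ⟨fun hr => ⟨b, hr, hb⟩, ?_⟩
        rintro ⟨b', hr, hb'⟩
        rwa [← encode_injective (hb'.trans hb.symm)]
    rw [Nat.mem_rfind]
    refine ⟨?_, fun {m} hm => ?_⟩
    · simp only [PFun.coe_val, Part.mem_some_iff]
      exact ((hiff _).2 ⟨f a, hf1 a, rfl⟩).symm
    · simp only [PFun.coe_val, Part.mem_some_iff]
      symm
      rw [Bool.eq_false_iff, Ne, hiff]
      rw [hf2 a] at hm
      exact Nat.find_min (hP a) hm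
  · rw [hf2 a]
    exact Nat.find_min' (hP a) ⟨b, hb, rfl⟩

theorem ComputablePred.exists_re {R : α → β → Prop}
    (hR : ComputablePred fun q : α × β => R q.1 q.2) : REPred fun a => ∃ b, R a b := by
  classical
  have hdec : Computable₂ fun (a : α) (n : ℕ) =>
      (Option.casesOn (decode (α := β) n) false fun b => decide (R a b) : Bool) :=
    Computable.option_casesOn (Primrec.decode.to_comp.comp Computable.snd)
      (Computable.const false)
      (hR.decide.comp ((Computable.fst.comp Computable.fst).pair Computable.snd)).to₂
  refine (Partrec.rfind hdec.partrec₂).dom_re.of_eq fun a => ?_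
  rw [Nat.rfind_dom]
  simp only [PFun.coe_val, Part.mem_some_iff, Part.some_dom, implies_true, and_true]
  constructor
  · rintro ⟨n, hn⟩
    rcases h : decode (α := β) n with _ | b <;> rw [h] at hn
    · simp at hn
    · exact ⟨b, by simpa using hn.symm⟩
  · rintro ⟨b, hb⟩
    exact ⟨encode b, by simp [hb]⟩

/-- Post's theorem in terms of certificates. -/
theorem ComputablePred.of_certificates {γ : Type*} [Primcodable γ] {p : α → Prop}
    {R : α → β → Prop} {R' : α → γ → Prop}
    (hR : ComputablePred fun q : α × β => R q.1 q.2)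
    (hR' : ComputablePred fun q : α × γ => R' q.1 q.2)
    (h : ∀ a, p a ↔ ∃ b, R a b) (h' : ∀ a, ¬ p a ↔ ∃ c, R' a c) : ComputablePred p :=
  ComputablePred.computable_iff_re_compl_re'.2
    ⟨hR.exists_re.of_eq fun a => (h a).symm, hR'.exists_re.of_eq fun a => (h' a).symm⟩

end ComputabilityToolkit

namespace ProAb

open scoped commutatorElement Topology

variable {A : Type u}

/-! ### Words, generated subgroups and integral weights -/

section Words

theorem gen_le_iff (W : List (Word A)) (K : Subgroup (FreeGroup A)) :
    gen W ≤ K ↔ ∀ w ∈ W, FreeGroup.mk w ∈ K := by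
  simp [gen, Subgroup.closure_le, Set.subset_def]

theorem mk_mem_gen {W : List (Word A)} {w : Word A} (h : w ∈ W) : FreeGroup.mk w ∈ gen W :=
  Subgroup.subset_closure ⟨w, h, rfl⟩

theorem gen_mono {W W' : List (Word A)} (h : ∀ w ∈ W, w ∈ W') : gen W ≤ gen W' :=
  (gen_le_iff _ _).2 fun w hw => mk_mem_gen (h w hw)

theorem exists_gen_eq {H : Subgroup (FreeGroup A)} (h : H.FG) : ∃ W : List (Word A), H = gen W := by
  obtain ⟨S, rfl⟩ := h
  classical
  refine ⟨S.toList.map FreeGroup.toWord, ?_⟩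
  congr 1
  ext g
  simp [FreeGroup.mk_toWord]

theorem gen_fg (W : List (Word A)) : (gen W).FG := by
  refine (Subgroup.fg_iff _).2 ⟨_, rfl, ?_⟩
  exact (List.finite_toSet W).image FreeGroup.mk

theorem mk_cons (x : A × Bool) (w : Word A) :
    FreeGroup.mk (x :: w) = FreeGroup.mk [x] * FreeGroup.mk w := by
  rw [FreeGroup.mul_mk]; rfl

theorem mk_singleton_false (a : A) : FreeGroup.mk [(a, false)] = (FreeGroup.of a)⁻¹ := by
  simp [FreeGroup.of, FreeGroup.inv_mk, FreeGroup.invRev]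

theorem mk_singleton_true (a : A) : FreeGroup.mk [(a, true)] = FreeGroup.of a := rfl

/-- Two homomorphisms agree on a word if they agree on its letters. -/
theorem hom_mk_congr {G : Type*} [Group G] {φ ψ : FreeGroup A →* G} {w : Word A}
    (h : ∀ x ∈ w, φ (FreeGroup.of x.1) = ψ (FreeGroup.of x.1)) :
    φ (FreeGroup.mk w) = ψ (FreeGroup.mk w) := by
  induction w with
  | nil => simp [← FreeGroup.one_eq_mk]
  | cons x w ih =>
    rw [mk_cons, map_mul, map_mul, ih fun y hy => h y (by simp [hy])]
    congr 1
    obtain ⟨a, _ | _⟩ := x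
    · rw [mk_singleton_false, map_inv, map_inv, h (a, false) (by simp)]
    · rw [mk_singleton_true, h (a, true) (by simp)]

theorem hom_mk_eq_one {G : Type*} [Group G] {φ : FreeGroup A →* G} {w : Word A}
    (h : ∀ x ∈ w, φ (FreeGroup.of x.1) = 1) : φ (FreeGroup.mk w) = 1 := by
  rw [hom_mk_congr (ψ := 1) (by simpa using h)]
  rfl

theorem commutator_le_ker {G M : Type*} [Group G] [CommGroup M] (φ : G →* M) :
    commutator G ≤ φ.ker :=
  Abelianization.commutator_subset_ker φ

/-- The homomorphism onto `ℤ` with prescribed values on the letters. -/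
def wt (z : A → ℤ) : FreeGroup A →* Multiplicative ℤ :=
  FreeGroup.lift fun a => Multiplicative.ofAdd (z a)

@[simp] theorem wt_of (z : A → ℤ) (a : A) : wt z (FreeGroup.of a) = Multiplicative.ofAdd (z a) :=
  FreeGroup.lift_apply_of

end Words

/-! ### Detecting elements modulo `HF'` by weights -/

section Functionals

/-- A rational functional on the letters is a multiple of an integral one. -/
theorem exists_wt_of_rat (q : A → ℚ) (W : List (Word A)) :
    ∃ m : ℕ, 0 < m ∧ ∃ z : A → ℤ, ∀ w ∈ W,
      (((wt z (FreeGroup.mk w)).toAdd : ℤ) : ℚ) = m *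
        (FreeGroup.lift (fun a => Multiplicative.ofAdd (q a)) (FreeGroup.mk w)).toAdd := by
  -- A common denominator is needed only at the letters of `W`; the values of `z` elsewhere are
  -- arbitrary.
  obtain ⟨l, hl⟩ : ∃ l : List A, l = W.flatMap fun w => w.map Prod.fst := ⟨_, rfl⟩
  have hm : ∃ m : ℕ, 0 < m ∧ ∀ a ∈ l, ∃ k : ℤ, (k : ℚ) = m * q a := by
    clear hl
    induction l with
    | nil => exact ⟨1, one_pos, by simp⟩
    | cons b l ih =>
      obtain ⟨m, hm, h⟩ := ih
      refine ⟨m * (q b).den, Nat.mul_pos hm (q b).den_pos, ?_⟩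
      intro a ha
      rcases List.mem_cons.1 ha with rfl | ha
      · refine ⟨m * (q a).num, ?_⟩
        push_cast
        rw [mul_assoc, Rat.den_mul_eq_num]
      · obtain ⟨k, hk⟩ := h a ha
        refine ⟨k * (q b).den, ?_⟩
        push_cast
        rw [hk]
        ring
  obtain ⟨m, hm, h⟩ := hm
  choose! z hz using h
  refine ⟨m, hm, z, fun w hw => ?_⟩
  let c : Multiplicative ℤ →* Multiplicative ℚ := AddMonoidHom.toMultiplicative (Int.castAddHom ℚ)
  let d : Multiplicative ℚ →* Multiplicative ℚ :=
    AddMonoidHom.toMultiplicative (AddMonoidHom.mulLeft (m : ℚ))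
  have key : (c.comp (wt z)) (FreeGroup.mk w) =
      (d.comp (FreeGroup.lift fun a => Multiplicative.ofAdd (q a))) (FreeGroup.mk w) := by
    refine hom_mk_congr fun x hx => ?_
    have : x.1 ∈ l := by
      rw [hl, List.mem_flatMap]
      exact ⟨w, hw, List.mem_map_of_mem hx⟩
    have h1 := hz _ this
    simp only [MonoidHom.comp_apply, wt_of, FreeGroup.lift_apply_of]
    exact congrArg Multiplicative.ofAdd h1
  exact congrArg Multiplicative.toAdd key

variable (W : List (Word A))

/-- The weight modulo `m` has an abelian target, so it kills commutators. The case `m = 0` is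
included and speaks of weights that vanish. -/
theorem wt_gen_sup_commutator {m : ℕ} {z : A → ℤ}
    (hz : ∀ w ∈ W, (m : ℤ) ∣ (wt z (FreeGroup.mk w)).toAdd) {g : FreeGroup A}
    (hg : g ∈ gen W ⊔ commutator (FreeGroup A)) : (m : ℤ) ∣ (wt z g).toAdd := by
  let ρ : FreeGroup A →* Multiplicative (ZMod m) :=
    (AddMonoidHom.toMultiplicative (Int.castAddHom (ZMod m))).comp (wt z)
  have hρ : ∀ g, (m : ℤ) ∣ (wt z g).toAdd ↔ g ∈ ρ.ker := fun g => by
    rw [← ZMod.intCast_zmod_eq_zero_iff_dvd, MonoidHom.mem_ker]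
    rfl
  rw [hρ]
  refine sup_le ((gen_le_iff _ _).2 fun w hw => ?_) (commutator_le_ker ρ) hg
  exact (hρ _).1 (hz w hw)

/-- Elements outside `HF'` are detected by homomorphisms to finite cyclic groups. -/
theorem exists_wt_not_dvd {u : Word A}
    (hu : FreeGroup.mk u ∉ gen W ⊔ commutator (FreeGroup A)) :
    ∃ m : ℕ, 0 < m ∧ ∃ z : A → ℤ, (∀ w ∈ W, (m : ℤ) ∣ (wt z (FreeGroup.mk w)).toAdd) ∧
      ¬ (m : ℤ) ∣ (wt z (FreeGroup.mk u)).toAdd := by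
  set K := gen W ⊔ commutator (FreeGroup A) with hK
  have hn : K.Normal := Subgroup.Normal.of_commutator_le _ le_sup_right
  have hc : IsMulCommutative (FreeGroup A ⧸ K) :=
    Subgroup.Normal.quotient_commutative_iff_commutator_le.2 le_sup_right
  let _ : CommGroup (FreeGroup A ⧸ K) :=
    { (inferInstance : Group (FreeGroup A ⧸ K)) with mul_comm := hc.1.1 }
  have hne : Additive.ofMul (QuotientGroup.mk (FreeGroup.mk u) : FreeGroup A ⧸ K) ≠ 0 := by
    intro h
    exact hu ((QuotientGroup.eq_one_iff _).1 (Additive.ofMul.injective h))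
  -- Characters to the divisible group `ℚ/ℤ` separate the points of an abelian group.
  obtain ⟨χ, hχ⟩ := CharacterModule.exists_character_apply_ne_zero_of_ne_zero hne
  let χ' : Additive (FreeGroup A ⧸ K) →+ AddCircle (1 : ℚ) := χ
  let ψ : FreeGroup A →* Multiplicative (AddCircle (1 : ℚ)) :=
    (AddMonoidHom.toMultiplicativeRight χ').comp (QuotientGroup.mk' K)
  have hψK : ∀ g ∈ K, ψ g = 1 := fun g hg => by
    have : (QuotientGroup.mk' K) g = 1 := (QuotientGroup.eq_one_iff _).2 hg
    rw [MonoidHom.comp_apply, this, map_one]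
  have hψu : ψ (FreeGroup.mk u) ≠ 1 := fun h => hχ (Multiplicative.ofAdd.injective h)
  have hlift : ∀ a, ∃ q : ℚ, (q : AddCircle (1 : ℚ)) = (ψ (FreeGroup.of a)).toAdd := fun a =>
    QuotientAddGroup.mk_surjective _
  choose q hq using hlift
  -- On the words of `u :: W` the weight is `m` times the rational lift of `ψ`; hence `m` divides it
  -- exactly when the lift is an integer, that is, when `ψ` is trivial.
  obtain ⟨m, hm, z, hz⟩ := exists_wt_of_rat q (u :: W)
  let π : Multiplicative ℚ →* Multiplicative (AddCircle (1 : ℚ)) :=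
    AddMonoidHom.toMultiplicative (QuotientAddGroup.mk' (AddSubgroup.zmultiples (1 : ℚ)))
  have hπ : π.comp (FreeGroup.lift fun a => Multiplicative.ofAdd (q a)) = ψ := by
    ext a
    simp only [MonoidHom.comp_apply, FreeGroup.lift_apply_of]
    exact congrArg Multiplicative.ofAdd (hq a)
  have hiff : ∀ w ∈ u :: W, (m : ℤ) ∣ (wt z (FreeGroup.mk w)).toAdd ↔ ψ (FreeGroup.mk w) = 1 := by
    intro w hw
    have h1 := hz w hw
    rw [← hπ]
    set r := FreeGroup.lift (fun a => Multiplicative.ofAdd (q a)) (FreeGroup.mk w)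
    have h2 : (π.comp (FreeGroup.lift fun a => Multiplicative.ofAdd (q a))) (FreeGroup.mk w) = 1 ↔
        ((r.toAdd : ℚ) : AddCircle (1 : ℚ)) = 0 := Iff.rfl
    rw [h2, AddCircle.coe_eq_zero_iff]
    have hm' : (m : ℚ) ≠ 0 := by positivity
    constructor
    · rintro ⟨c, hc⟩
      refine ⟨c, ?_⟩
      rw [hc] at h1
      push_cast at h1
      simpa using mul_left_cancel₀ hm' h1
    · rintro ⟨c, hc⟩
      refine ⟨c, ?_⟩
      rw [← hc] at h1
      simp only [zsmul_eq_mul, mul_one] at h1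
      exact_mod_cast h1
  refine ⟨m, hm, z, fun w hw => ?_, fun h => hψu ((hiff u (by simp)).1 h)⟩
  exact (hiff w (by simp [hw])).2 (hψK _ (le_sup_left (a := gen W) (mk_mem_gen hw)))

/-- A letter of infinite order modulo `HF'` is detected by a homomorphism to `ℤ`. -/
theorem exists_wt_eq_zero {a : A}
    (ha : ∀ m : ℕ, 0 < m → FreeGroup.of a ^ m ∉ gen W ⊔ commutator (FreeGroup A)) :
    ∃ z : A → ℤ, (∀ w ∈ W, wt z (FreeGroup.mk w) = 1) ∧ z a ≠ 0 := by
  set K := gen W ⊔ commutator (FreeGroup A) with hK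
  have hn : K.Normal := Subgroup.Normal.of_commutator_le _ le_sup_right
  have hc : IsMulCommutative (FreeGroup A ⧸ K) :=
    Subgroup.Normal.quotient_commutative_iff_commutator_le.2 le_sup_right
  let _ : CommGroup (FreeGroup A ⧸ K) :=
    { (inferInstance : Group (FreeGroup A ⧸ K)) with mul_comm := hc.1.1 }
  let x : Additive (FreeGroup A ⧸ K) := Additive.ofMul (QuotientGroup.mk (FreeGroup.of a))
  have hx : ∀ m : ℕ, 0 < m → m • x ≠ 0 := fun m hm h => by
    refine ha m hm ((QuotientGroup.eq_one_iff _).1 ?_)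
    exact Additive.ofMul.injective h
  have hinj : Function.Injective (zmultiplesHom _ x) := by
    rw [injective_iff_map_eq_zero]
    intro n hn0
    rw [zmultiplesHom_apply] at hn0
    by_contra hne
    refine hx n.natAbs (Int.natAbs_pos.2 hne) ?_
    rcases Int.natAbs_eq n with h | h <;> rw [h] at hn0 <;> simpa using hn0
  -- As `x` has infinite order and `ℚ` is divisible, hence injective, the map `n • x ↦ n` extends to
  -- the whole quotient.
  obtain ⟨h, hh⟩ := (Module.Baer.of_divisible ℚ).extension_property_addMonoidHom _ hinj
    (Int.castAddHom ℚ)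
  have hx1 : h x = 1 := by simpa using DFunLike.congr_fun hh (1 : ℤ)
  let ψ : FreeGroup A →* Multiplicative ℚ :=
    (AddMonoidHom.toMultiplicativeRight h).comp (QuotientGroup.mk' K)
  have hψK : ∀ g ∈ K, ψ g = 1 := fun g hg => by
    have : (QuotientGroup.mk' K) g = 1 := (QuotientGroup.eq_one_iff _).2 hg
    rw [MonoidHom.comp_apply, this, map_one]
  obtain ⟨m, hm, z, hz⟩ := exists_wt_of_rat (fun b => (ψ (FreeGroup.of b)).toAdd)
    ([(a, true)] :: W)
  have hψ : FreeGroup.lift (fun b => Multiplicative.ofAdd (ψ (FreeGroup.of b)).toAdd) = ψ := by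
    ext b
    simp
  rw [hψ] at hz
  refine ⟨z, fun w hw => ?_, fun h0 => ?_⟩
  · have h1 := hz w (by simp [hw])
    rw [hψK _ (le_sup_left (a := gen W) (mk_mem_gen hw))] at h1
    simp only [toAdd_one, mul_zero, Int.cast_eq_zero] at h1
    exact Multiplicative.toAdd.injective h1
  · have h1 := hz [(a, true)] (by simp)
    have h2 : (ψ (FreeGroup.of a)).toAdd = 1 := hx1
    rw [mk_singleton_true, h2, wt_of, toAdd_ofAdd, h0] at h1
    have hm' : (m : ℚ) ≠ 0 := by positivity
    simp [eq_comm, hm'] at h1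

end Functionals

/-! ### The closure is `HF'` -/

section Closure

/-- An element of the derived subgroup has the same image as `1` under every homomorphism to an
abelian group, so it has the same neighbourhoods as `1 ∈ H`. -/
theorem commutator_le_clAb {G : Type u} [Group G] (H : Subgroup G) : commutator G ≤ clAb H := by
  intro f hf
  let _ := proAbTopology G
  have hnhds : nhds f = nhds (1 : G) := by
    have hind : ∀ (Q : Type) (_ : CommGroup Q) (φ : G →* Q),
        @nhds G (TopologicalSpace.induced φ ⊥) f = @nhds G (TopologicalSpace.induced φ ⊥) 1 := by
      intro Q _ φ
      let _ : TopologicalSpace Q := ⊥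
      have : φ f = φ 1 := by rw [map_one]; exact commutator_le_ker φ hf
      rw [nhds_induced, nhds_induced, this]
    change @nhds G (proAbTopology G) f = @nhds G (proAbTopology G) 1
    simp only [nhds_iInf, hind]
  change f ∈ closure (H : Set G)
  rw [mem_closure_iff_nhds, hnhds, ← mem_closure_iff_nhds]
  exact subset_closure H.one_mem

theorem le_clAb {G : Type u} [Group G] (H : Subgroup G) : H ≤ clAb H :=
  @Subgroup.le_topologicalClosure G (proAbTopology G) _ (isTopologicalGroup_proAb G) H

theorem proAbTopology_le {G : Type u} [Group G] {Q : Type} [hQ : CommGroup Q]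
    [hf : Finite Q] (φ : G →* Q) : proAbTopology G ≤ TopologicalSpace.induced φ ⊥ :=
  (iInf_le _ Q).trans ((iInf_le _ hQ).trans ((iInf_le _ hf).trans (iInf_le _ φ)))

theorem isOpen_proAb_preimage {G : Type u} [Group G] {Q : Type} [CommGroup Q]
    [Finite Q] (φ : G →* Q) (s : Set Q) : IsOpen[proAbTopology G] (φ ⁻¹' s) := by
  have h : IsOpen[TopologicalSpace.induced φ ⊥] (φ ⁻¹' s) := by
    let _ : TopologicalSpace Q := ⊥
    have : DiscreteTopology Q := ⟨rfl⟩
    exact isOpen_induced_iff.2 ⟨s, isOpen_discrete _, rfl⟩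
  exact proAbTopology_le φ _ h

/-- The fibre of `φ` through `x` is an open neighbourhood of `x` disjoint from `H`. -/
theorem notMem_clAb {G : Type u} [Group G] {H : Subgroup G} {x : G} {Q : Type} [CommGroup Q]
    [Finite Q] (φ : G →* Q) (hH : H ≤ φ.ker) (hx : φ x ≠ 1) : x ∉ clAb H := by
  intro hmem
  obtain ⟨h, h1, h2⟩ := (@mem_closure_iff G (proAbTopology G) _ _).1 hmem _
    (isOpen_proAb_preimage φ {φ x}) (Set.mem_singleton _)
  have h3 : φ h = φ x := h1
  exact hx (h3.symm.trans (hH h2))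
theorem clAb_gen (W : List (Word A)) : clAb (gen W) = gen W ⊔ commutator (FreeGroup A) := by
  refine le_antisymm (fun x hx => ?_) (sup_le (le_clAb _) (commutator_le_clAb _))
  by_contra hxK
  classical
  rw [← FreeGroup.mk_toWord (x := x)] at hx hxK
  obtain ⟨m, hm, z, hz, hu⟩ := exists_wt_not_dvd W hxK
  have : NeZero m := ⟨hm.ne'⟩
  let ρ : FreeGroup A →* Multiplicative (ZMod m) :=
    (AddMonoidHom.toMultiplicative (Int.castAddHom (ZMod m))).comp (wt z)
  have hρ : ∀ g, (m : ℤ) ∣ (wt z g).toAdd ↔ ρ g = 1 := fun g => by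
    rw [← ZMod.intCast_zmod_eq_zero_iff_dvd]
    rfl
  have : Finite (Multiplicative (ZMod m)) := inferInstanceAs (Finite (ZMod m))
  refine notMem_clAb ρ ((gen_le_iff _ _).2 fun w hw => (hρ _).1 (hz w hw)) ?_ hx
  rwa [Ne, ← hρ]

theorem clAb_eq_sup {H : Subgroup (FreeGroup A)} (h : H.FG) :
    clAb H = H ⊔ commutator (FreeGroup A) := by
  obtain ⟨W, rfl⟩ := exists_gen_eq h
  exact clAb_gen W

theorem isAbClosed_iff {H : Subgroup (FreeGroup A)} (h : H.FG) :
    IsAbClosed H ↔ commutator (FreeGroup A) ≤ H := by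
  let _ := proAbTopology (FreeGroup A)
  have h1 : IsAbClosed H ↔ clAb H = H := by
    rw [SetLike.ext'_iff]
    exact closure_eq_iff_isClosed.symm
  rw [h1, clAb_eq_sup h, sup_eq_left]

theorem isAbDense_iff {H : Subgroup (FreeGroup A)} :
    IsAbDense H ↔ clAb H = ⊤ := by
  let _ := proAbTopology (FreeGroup A)
  rw [SetLike.ext'_iff]
  exact dense_iff_closure_eq

end Closure

/-! ### Infinite alphabets -/

section InfiniteAlphabet

theorem exists_notMem_letters [Infinite A] (W : List (Word A)) (l : List A) :
    ∃ a, a ∉ l ∧ ∀ w ∈ W, ∀ x ∈ w, x.1 ≠ a := by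
  classical
  obtain ⟨a, ha⟩ := Infinite.exists_notMem_finset
    (l ++ W.flatMap fun w => w.map Prod.fst).toFinset
  simp only [List.mem_toFinset, List.mem_append, List.mem_flatMap, not_or, not_exists,
    not_and] at ha
  exact ⟨a, ha.1, fun w hw x hx h => ha.2 w hw (h ▸ List.mem_map_of_mem hx)⟩

/-- Finitely many generators avoid two letters `a` and `b`. Sending these to noncommuting
transpositions and all other letters to `1` kills the subgroup but not `⁅a, b⁆`. -/
theorem not_fg_of_commutator_le [Infinite A] {K : Subgroup (FreeGroup A)}
    (hK : commutator (FreeGroup A) ≤ K) : ¬ K.FG := by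
  classical
  intro hfg
  obtain ⟨W, rfl⟩ := exists_gen_eq hfg
  obtain ⟨a, -, ha⟩ := exists_notMem_letters W []
  obtain ⟨b, hb, hb'⟩ := exists_notMem_letters W [a]
  have hab : b ≠ a := by simpa using hb
  let φ : FreeGroup A →* Equiv.Perm (Fin 3) := FreeGroup.lift fun c =>
    if c = a then Equiv.swap 0 1 else if c = b then Equiv.swap 1 2 else 1
  have hker : gen W ≤ φ.ker := (gen_le_iff _ _).2 fun w hw => hom_mk_eq_one fun x hx => by
    simp [φ, ha w hw x hx, hb' w hw x hx]
  have hmem : ⁅FreeGroup.of a, FreeGroup.of b⁆ ∈ φ.ker :=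
    hker (hK (Subgroup.commutator_mem_commutator trivial trivial))
  rw [MonoidHom.mem_ker, map_commutatorElement] at hmem
  simp only [φ, FreeGroup.lift_apply_of, if_true, if_neg hab] at hmem
  revert hmem
  decide

/-- The exponent sum of a letter that does not occur in `W` vanishes on `HF'` but not on that
letter. -/
theorem sup_commutator_ne_top [Infinite A] (W : List (Word A)) :
    gen W ⊔ commutator (FreeGroup A) ≠ ⊤ := by
  classical
  intro htop
  obtain ⟨a, -, ha⟩ := exists_notMem_letters W []
  have h := wt_gen_sup_commutator W (m := 0) (z := fun c => if c = a then 1 else 0)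
    (fun w hw => by
      rw [hom_mk_eq_one fun x hx => by simp [ha w hw x hx]]
      simp)
    (htop ▸ Subgroup.mem_top (FreeGroup.of a))
  simp at h

end InfiniteAlphabet

/-! ### Finite generation and finite index -/

section FiniteIndex

/-- The affine maps of `ℚ` by which the letters act: `x ↦ 2 ^ z c * x + d c`. -/
noncomputable def affineHom (z : A → ℤ) (d : A → ℚ) : FreeGroup A →* Equiv.Perm ℚ :=
  FreeGroup.lift fun c =>
    (Equiv.mulLeft₀ ((2 : ℚ) ^ z c) (by positivity)).trans (Equiv.addRight (d c))

theorem affineHom_of (z : A → ℤ) (d : A → ℚ) (c : A) (x : ℚ) :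
    affineHom z d (FreeGroup.of c) x = 2 ^ z c * x + d c := by
  simp [affineHom]

/-- Slopes multiply under composition, so the slope of `g` is determined by its weight and only the
value at `0` involves `d`. -/
theorem affineHom_apply (z : A → ℤ) (d : A → ℚ) (g : FreeGroup A) (x : ℚ) :
    affineHom z d g x = 2 ^ (wt z g).toAdd * x + affineHom z d g 0 := by
  induction g using FreeGroup.induction_on generalizing x with
  | C1 => simp
  | of c => simp [affineHom_of]
  | inv_of c ih =>
    have h : ∀ y : ℚ, affineHom z d (FreeGroup.of c)⁻¹ y = 2 ^ (-z c) * (y - d c) := fun y => by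
      rw [map_inv, Equiv.Perm.inv_eq_iff_eq, affineHom_of, ← mul_assoc, ← zpow_add₀ two_ne_zero]
      simp
    rw [h, h]
    simp
    ring
  | mul g h ihg ihh =>
    simp only [map_mul, Equiv.Perm.mul_apply]
    rw [ihg, ihh x, ihg (affineHom z d h 0), toAdd_mul, zpow_add₀ two_ne_zero]
    ring

/-- A finitely generated subgroup of translations has bounded denominators. -/
theorem exists_common_denominator {z : A → ℤ} (d : A → ℚ) {K : Subgroup (FreeGroup A)}
    (hK : K.FG) (hz : K ≤ (wt z).ker) :
    ∃ D : ℕ, 0 < D ∧ ∀ g ∈ K, ∃ n : ℤ, (n : ℚ) = D * affineHom z d g 0 := by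
  obtain ⟨W, rfl⟩ := exists_gen_eq hK
  have hD : ∃ D : ℕ, 0 < D ∧ ∀ w ∈ W, ∃ n : ℤ,
      (n : ℚ) = D * affineHom z d (FreeGroup.mk w) 0 := by
    clear hK hz
    induction W with
    | nil => exact ⟨1, one_pos, by simp⟩
    | cons v W ih =>
      obtain ⟨D, hD, h⟩ := ih
      set q := affineHom z d (FreeGroup.mk v) 0 with hq
      refine ⟨D * q.den, Nat.mul_pos hD q.den_pos, fun w hw => ?_⟩
      rcases List.mem_cons.1 hw with rfl | hw
      · refine ⟨D * q.num, ?_⟩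
        push_cast
        rw [← hq, mul_assoc, Rat.den_mul_eq_num]
      · obtain ⟨k, hk⟩ := h w hw
        refine ⟨k * q.den, ?_⟩
        push_cast
        rw [hk]
        ring
  obtain ⟨D, hD, h⟩ := hD
  -- Weight zero means slope one. Translations add up, so a common denominator for the generators
  -- serves the whole subgroup.
  have htr : ∀ g ∈ gen W, ∀ x, affineHom z d g x = x + affineHom z d g 0 := fun g hg x => by
    rw [affineHom_apply, (hz hg : wt z g = 1)]
    simp
  refine ⟨D, hD, fun g hg => ?_⟩
  induction hg using Subgroup.closure_induction with
  | mem g hg =>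
    obtain ⟨w, hw, rfl⟩ := hg
    exact h w hw
  | one => exact ⟨0, by simp⟩
  | mul g g' hg hg' ih ih' =>
    obtain ⟨n, hn⟩ := ih
    obtain ⟨n', hn'⟩ := ih'
    refine ⟨n' + n, ?_⟩
    rw [map_mul, Equiv.Perm.mul_apply, htr g hg]
    push_cast
    rw [hn, hn']
    ring
  | inv g hg ih =>
    obtain ⟨n, hn⟩ := ih
    refine ⟨-n, ?_⟩
    have h1 : affineHom z d g⁻¹ 0 + affineHom z d g 0 = 0 := by
      rw [← htr g hg, ← Equiv.Perm.mul_apply, ← map_mul]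
      simp
    push_cast
    rw [hn, eq_neg_of_add_eq_zero_left h1]
    ring

/-- A finitely generated subgroup which contains the derived subgroup of a free group of rank at
least two admits no homomorphism onto an infinite cyclic quotient. -/
theorem not_fg_of_le_ker_wt {K : Subgroup (FreeGroup A)} (hK : K.FG)
    (hcomm : commutator (FreeGroup A) ≤ K) {z : A → ℤ} (hz : K ≤ (wt z).ker) {a b : A}
    (hab : b ≠ a) : z a = 0 := by
  classical
  by_contra ha
  -- Here `a` acts as a homothety with fixed point `0`, while `b` also translates by `1`.
  obtain ⟨D, hD, h⟩ := exists_common_denominator (fun c => if c = b then 1 else 0) hK hz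
  set ρ := affineHom z (fun c => if c = b then (1 : ℚ) else 0) with hρ
  have hn : K.Normal := Subgroup.Normal.of_commutator_le _ hcomm
  have hρa : ∀ x, ρ (FreeGroup.of a) x = 2 ^ z a * x := fun x => by
    simp [hρ, affineHom_of, hab.symm]
  have hρa' : ∀ x, ρ (FreeGroup.of a)⁻¹ x = 2 ^ (-z a) * x := fun x => by
    rw [map_inv, Equiv.Perm.inv_eq_iff_eq, hρa, ← mul_assoc, ← zpow_add₀ two_ne_zero]
    simp
  have hρb : ∀ x, ρ (FreeGroup.of b) x = 2 ^ z b * x + 1 := fun x => by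
    simp [hρ, affineHom_of]
  have hρb' : ∀ x, ρ (FreeGroup.of b)⁻¹ x = 2 ^ (-z b) * (x - 1) := fun x => by
    rw [map_inv, Equiv.Perm.inv_eq_iff_eq, hρb, ← mul_assoc, ← zpow_add₀ two_ne_zero]
    simp
  have hg : ⁅FreeGroup.of a, FreeGroup.of b⁆ ∈ K :=
    hcomm (Subgroup.commutator_mem_commutator trivial trivial)
  set g := ⁅FreeGroup.of a, FreeGroup.of b⁆ with hgdef
  have hg0 : ρ g 0 = 2 ^ z a - 1 := by
    rw [hgdef, commutatorElement_def, map_mul, map_mul, map_mul]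
    simp only [Equiv.Perm.mul_apply]
    rw [hρb', hρa', hρb, hρa]
    have h1 : (2 : ℚ) ^ z a * 2 ^ (-z a) = 1 := by rw [← zpow_add₀ two_ne_zero]; simp
    have h2 : (2 : ℚ) ^ z b * 2 ^ (-z b) = 1 := by rw [← zpow_add₀ two_ne_zero]; simp
    linear_combination (-(2 : ℚ) ^ z b * 2 ^ (-z b)) * h1 - h2
  have hpow : ∀ (n : ℤ) (x : ℚ), ρ (FreeGroup.of a ^ n) x = 2 ^ (n * z a) * x := by
    intro n x
    rw [hρ, affineHom_apply]
    have h0 : ρ (FreeGroup.of a ^ n) 0 = 0 := by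
      rw [map_zpow]
      exact Equiv.Perm.zpow_apply_eq_self_of_apply_eq_self (by simp [hρa]) n
    rw [← hρ, h0, map_zpow, wt_of]
    simp
  -- Conjugation by `a ^ n` scales the translation `⁅a, b⁆` by `2 ^ (n * z a)`, and the conjugates
  -- stay in the normal subgroup `K`.
  have hconj : ∀ n : ℤ, ∃ k : ℤ, (k : ℚ) = D * (2 ^ (n * z a) * (2 ^ z a - 1)) := by
    intro n
    obtain ⟨k, hk⟩ := h _ (hn.conj_mem g hg (FreeGroup.of a ^ n))
    refine ⟨k, ?_⟩
    rw [hk, map_mul, map_mul, Equiv.Perm.mul_apply, Equiv.Perm.mul_apply, ← zpow_neg, hpow (-n),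
      mul_zero, hg0, hpow]
  have hc0 : (D : ℚ) * (2 ^ z a - 1) ≠ 0 := by
    have : (2 : ℚ) ^ z a ≠ 1 := by
      rw [Ne, zpow_eq_one_iff_right₀ (by norm_num) (by norm_num)]
      exact ha
    exact mul_ne_zero (by positivity) (sub_ne_zero.2 this)
  -- With `n = -(j * z a)` the exponent `n * z a = -j * (z a)²` is at most `-j` whatever the sign of
  -- `z a`. The resulting nonzero integer `k` would have absolute value less than `1`.
  obtain ⟨j, hj⟩ := pow_unbounded_of_one_lt |(D : ℚ) * (2 ^ z a - 1)| (by norm_num : (1 : ℚ) < 2)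
  obtain ⟨k, hk⟩ := hconj (-(j * z a))
  have hsq : (j : ℤ) ≤ j * z a * z a := by
    have : 1 ≤ z a * z a := by have := mul_self_pos.2 ha; omega
    nlinarith
  have hle : (2 : ℚ) ^ j ≤ 2 ^ ((j : ℤ) * z a * z a) := by
    rw [← zpow_natCast]
    exact zpow_le_zpow_right₀ (by norm_num) hsq
  have hk' : (k : ℚ) * 2 ^ ((j : ℤ) * z a * z a) = D * (2 ^ z a - 1) := by
    rw [hk]
    have h1 : (2 : ℚ) ^ (-((j : ℤ) * z a) * z a) * 2 ^ ((j : ℤ) * z a * z a) = 1 := by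
      rw [← zpow_add₀ two_ne_zero]; simp
    linear_combination (D * (2 ^ z a - 1) : ℚ) * h1
  have hk0 : k ≠ 0 := by
    rintro rfl
    rw [Int.cast_zero, zero_mul] at hk'
    exact hc0 hk'.symm
  have hk1 : (1 : ℚ) ≤ |(k : ℚ)| := by
    have := Int.one_le_abs hk0
    exact_mod_cast this
  have habs := congrArg abs hk'
  rw [abs_mul, abs_of_pos (a := (2 : ℚ) ^ ((j : ℤ) * z a * z a)) (by positivity)] at habs
  have := mul_le_mul_of_nonneg_right hk1 (zpow_pos two_pos ((j : ℤ) * z a * z a) : (0 : ℚ) < _).le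
  linarith

/-- The quotient is a finitely generated abelian group generated by torsion elements, hence finite.
-/
theorem finiteIndex_of_pow_mem [Finite A] {K : Subgroup (FreeGroup A)}
    (hcomm : commutator (FreeGroup A) ≤ K)
    (h : ∀ a, ∃ m : ℕ, 0 < m ∧ FreeGroup.of a ^ m ∈ K) : K.FiniteIndex := by
  have hn : K.Normal := Subgroup.Normal.of_commutator_le _ hcomm
  have hc : IsMulCommutative (FreeGroup A ⧸ K) :=
    Subgroup.Normal.quotient_commutative_iff_commutator_le.2 hcomm
  let _ : CommGroup (FreeGroup A ⧸ K) :=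
    { (inferInstance : Group (FreeGroup A ⧸ K)) with mul_comm := hc.1.1 }
  have htop : (CommGroup.torsion (FreeGroup A ⧸ K)).comap (QuotientGroup.mk' K) = ⊤ := by
    rw [eq_top_iff, ← FreeGroup.closure_range_of, Subgroup.closure_le]
    rintro _ ⟨a, rfl⟩
    obtain ⟨m, hm, hmem⟩ := h a
    change IsOfFinOrder (QuotientGroup.mk' K (FreeGroup.of a))
    refine isOfFinOrder_iff_pow_eq_one.2 ⟨m, hm, ?_⟩
    rw [← map_pow]
    exact (QuotientGroup.eq_one_iff _).2 hmem
  have htor : IsMulTorsion (FreeGroup A ⧸ K) := by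
    rw [← CommGroup.torsion_eq_top_iff, eq_top_iff]
    intro x _
    obtain ⟨g, rfl⟩ := QuotientGroup.mk_surjective x
    have : g ∈ (CommGroup.torsion (FreeGroup A ⧸ K)).comap (QuotientGroup.mk' K) := by
      rw [htop]; trivial
    exact this
  have : Finite (FreeGroup A ⧸ K) := CommGroup.finite_of_fg_isMulTorsion _ htor
  exact Subgroup.finiteIndex_of_finite_quotient

theorem commutator_eq_bot_of_subsingleton [Subsingleton A] :
    commutator (FreeGroup A) = ⊥ := by
  rw [commutator_def, Subgroup.commutator_eq_bot_iff_le_centralizer, ← FreeGroup.closure_range_of,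
    Subgroup.le_centralizer_iff_isMulCommutative]
  exact Subgroup.isMulCommutative_closure (by
    rintro _ ⟨a, rfl⟩ _ ⟨b, rfl⟩
    rw [Subsingleton.elim a b])

/-- A letter `a` of infinite order modulo `HF'` gives a weight that kills `HF'` but not `a`. By
`not_fg_of_le_ker_wt` there is no other letter, so `H` consists of powers of `a` of weight zero and
is trivial: the excluded case. -/
theorem exists_pow_mem_of_fg {W : List (Word A)}
    (hfg : (gen W ⊔ commutator (FreeGroup A)).FG)
    (hex : ¬ (Nat.card A = 1 ∧ gen W = ⊥)) (a : A) :
    ∃ m : ℕ, 0 < m ∧ FreeGroup.of a ^ m ∈ gen W ⊔ commutator (FreeGroup A) := by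
  by_contra! h
  obtain ⟨z, hz, hza⟩ := exists_wt_eq_zero W h
  have hker : gen W ⊔ commutator (FreeGroup A) ≤ (wt z).ker :=
    sup_le ((gen_le_iff _ _).2 hz) (commutator_le_ker _)
  have huniq : ∀ b, b = a := fun b => by
    by_contra hb
    exact hza (not_fg_of_le_ker_wt hfg le_sup_right hker hb)
  refine hex ⟨Nat.card_eq_one_iff_exists.2 ⟨a, huniq⟩, ?_⟩
  rw [eq_bot_iff]
  intro g hg
  have hgz : g ∈ Subgroup.zpowers (FreeGroup.of a) := by
    have htop : Subgroup.zpowers (FreeGroup.of a) = ⊤ := by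
      rw [eq_top_iff, ← FreeGroup.closure_range_of, Subgroup.closure_le]
      rintro _ ⟨b, rfl⟩
      rw [huniq b]
      exact Subgroup.mem_zpowers _
    rw [htop]; trivial
  obtain ⟨n, rfl⟩ := hgz
  have h1 : wt z (FreeGroup.of a ^ n) = 1 := hker (le_sup_left (a := gen W) hg)
  rw [map_zpow, wt_of] at h1
  have h2 : n * z a = 0 := by simpa using congrArg Multiplicative.toAdd h1
  have h3 : n = 0 := by simpa [hza] using h2
  simp [h3]

/-- Conversely, a subgroup of finite index in a finitely generated group is finitely generated. -/
theorem fg_iff_finiteIndex [Finite A] {W : List (Word A)}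
    (hex : ¬ (Nat.card A = 1 ∧ gen W = ⊥)) :
    (gen W ⊔ commutator (FreeGroup A)).FG ↔
      (gen W ⊔ commutator (FreeGroup A)).FiniteIndex := by
  refine ⟨fun h => finiteIndex_of_pow_mem le_sup_right (exists_pow_mem_of_fg h hex), fun h => ?_⟩
  rw [← Group.fg_iff_subgroup_fg]
  infer_instance

theorem fg_iff_forall_pow_mem [Finite A] {W : List (Word A)}
    (hex : ¬ (Nat.card A = 1 ∧ gen W = ⊥)) :
    (gen W ⊔ commutator (FreeGroup A)).FG ↔
      ∀ a, ∃ m : ℕ, 0 < m ∧ FreeGroup.of a ^ m ∈ gen W ⊔ commutator (FreeGroup A) := by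
  refine ⟨fun h => exists_pow_mem_of_fg h hex, fun h => ?_⟩
  rw [fg_iff_finiteIndex hex]
  exact finiteIndex_of_pow_mem le_sup_right h

end FiniteIndex

/-! ### A finite test for containing the derived subgroup -/

section Normality

/-- The derived subgroup is contained in `gen W` if and only if finitely many conjugates of
generators and commutators of letters lie in `gen W`. -/
theorem commutator_le_gen_iff (W : List (Word A)) :
    commutator (FreeGroup A) ≤ gen W ↔
      (∀ a b : A, FreeGroup.mk [(a, true), (b, true), (a, false), (b, false)] ∈ gen W) ∧
      ∀ (a : A) (ε : Bool), ∀ w ∈ W, FreeGroup.mk ((a, ε) :: (w ++ [(a, !ε)])) ∈ gen W := by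
  have hcom : ∀ a b : A, FreeGroup.mk [(a, true), (b, true), (a, false), (b, false)] =
      ⁅FreeGroup.of a, FreeGroup.of b⁆ := fun a b => by
    simp [commutatorElement_def, FreeGroup.of, FreeGroup.inv_mk, FreeGroup.mul_mk,
      FreeGroup.invRev]
  have hconj : ∀ (a : A) (ε : Bool) (w : Word A), FreeGroup.mk ((a, ε) :: (w ++ [(a, !ε)])) =
      FreeGroup.mk [(a, ε)] * FreeGroup.mk w * (FreeGroup.mk [(a, ε)])⁻¹ := fun a ε w => by
    simp [FreeGroup.inv_mk, FreeGroup.mul_mk, FreeGroup.invRev]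
  simp only [hcom, hconj]
  constructor
  · intro h
    have hn : (gen W).Normal := Subgroup.Normal.of_commutator_le _ h
    exact ⟨fun a b => h (Subgroup.commutator_mem_commutator trivial trivial),
      fun a ε w hw => hn.conj_mem _ (mk_mem_gen hw) _⟩
  · rintro ⟨h1, h2⟩
    have h2' : ∀ (a : A) (ε : Bool), gen W ≤
        (gen W).comap (MulAut.conj (FreeGroup.mk [(a, ε)])).toMonoidHom := fun a ε =>
      (gen_le_iff _ _).2 fun w hw => h2 a ε w hw
    -- Both signs of the letter are needed: a conjugate contained in `gen W` might be a proper
    -- subgroup of it.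
    have hn : (gen W).Normal := by
      rw [← Subgroup.normalizer_eq_top_iff, eq_top_iff, ← FreeGroup.closure_range_of,
        Subgroup.closure_le]
      rintro _ ⟨a, rfl⟩
      rw [SetLike.mem_coe, Subgroup.mem_normalizer_iff]
      intro g
      refine ⟨fun hg => h2' a true hg, fun hg => ?_⟩
      have := h2' a false hg
      simpa [mk_singleton_false, mul_assoc] using this
    rw [← Subgroup.Normal.quotient_commutative_iff_commutator_le]
    -- The quotient is generated by the images of the letters, and these commute.
    have htop : (⊤ : Subgroup (FreeGroup A ⧸ gen W)) =
        Subgroup.closure (Set.range fun a => QuotientGroup.mk' (gen W) (FreeGroup.of a)) := by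
      rw [← Function.comp_def, Set.range_comp, ← MonoidHom.map_closure,
        FreeGroup.closure_range_of, ← MonoidHom.range_eq_map,
        MonoidHom.range_eq_top.2 (QuotientGroup.mk'_surjective _)]
    have hcomm : IsMulCommutative (⊤ : Subgroup (FreeGroup A ⧸ gen W)) := by
      rw [htop]
      refine Subgroup.isMulCommutative_closure ?_
      rintro _ ⟨a, rfl⟩ _ ⟨b, rfl⟩
      rw [← commutatorElement_eq_one_iff_mul_comm, ← map_commutatorElement]
      exact (QuotientGroup.eq_one_iff _).2 (h1 a b)
    exact ⟨⟨fun x y => congrArg Subtype.val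
      (hcomm.1.1 (⟨x, trivial⟩ : (⊤ : Subgroup (FreeGroup A ⧸ gen W))) ⟨y, trivial⟩)⟩⟩

end Normality

/-! ### Free reduction is primitive recursive -/

section PrimitiveRecursion

theorem primrec_invRev : Primrec (FreeGroup.invRev : Word ℕ → Word ℕ) :=
  Primrec.list_reverse.comp (Primrec.list_map Primrec.id
    ((Primrec.fst.comp Primrec.snd).pair (Primrec.not.comp (Primrec.snd.comp Primrec.snd))))

/-- Reduction is a right fold that cancels the new letter against the head of the word reduced so
far. It makes equality in the free group checkable. -/
theorem primrec_reduce : Primrec (FreeGroup.reduce : Word ℕ → Word ℕ) := by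
  have hstep : Primrec₂ fun (_ : Word ℕ) (q : (ℕ × Bool) × Word ℕ) =>
      (List.casesOn q.2 [q.1] fun hd tl =>
        if q.1.1 = hd.1 ∧ q.1.2 = !hd.2 then tl else q.1 :: hd :: tl : Word ℕ) := by
    refine Primrec.list_casesOn (f := fun r : Word ℕ × (ℕ × Bool) × Word ℕ => r.2.2)
      (g := fun r => [r.2.1])
      (h := fun r c => if r.2.1.1 = c.1.1 ∧ r.2.1.2 = !c.1.2 then c.2 else r.2.1 :: c.1 :: c.2)
      (Primrec.snd.comp Primrec.snd)
      (Primrec.list_cons.comp (Primrec.fst.comp Primrec.snd) (Primrec.const [])) ?_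
    have hx : Primrec fun t : (Word ℕ × (ℕ × Bool) × Word ℕ) × (ℕ × Bool) × Word ℕ => t.1.2.1 :=
      Primrec.fst.comp (Primrec.snd.comp Primrec.fst)
    have hh : Primrec fun t : (Word ℕ × (ℕ × Bool) × Word ℕ) × (ℕ × Bool) × Word ℕ => t.2.1 :=
      Primrec.fst.comp Primrec.snd
    have ht : Primrec fun t : (Word ℕ × (ℕ × Bool) × Word ℕ) × (ℕ × Bool) × Word ℕ => t.2.2 :=
      Primrec.snd.comp Primrec.snd
    exact Primrec.ite
      ((Primrec.eq.comp (Primrec.fst.comp hx) (Primrec.fst.comp hh)).and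
        (Primrec.eq.comp (Primrec.snd.comp hx) (Primrec.not.comp (Primrec.snd.comp hh))))
      ht (Primrec.list_cons.comp hx (Primrec.list_cons.comp hh ht))
  refine (Primrec.list_foldr Primrec.id (Primrec.const []) hstep).of_eq fun w => ?_
  induction w with
  | nil => rfl
  | cons x w ih =>
    rw [FreeGroup.reduce.cons, ← ih]
    rfl

theorem computablePred_mem {α β : Type*} [Primcodable α] [Primcodable β] {f : α → β}
    {l : α → List β} (hf : Computable f) (hl : Computable l) :
    ComputablePred fun a => f a ∈ l a := by
  classical
  refine (ComputablePred.forall_mem_list (p := fun a b => ¬ b = f a)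
    ((ComputablePred.eq Computable.snd (hf.comp Computable.fst)).not) hl).not.of_eq fun a => ?_
  simp

end PrimitiveRecursion

/-! ### Membership in finitely generated subgroups -/

section Membership

/-- The word obtained by substituting words for the letters of `E`. -/
def substWord (E : List (Word A × Bool)) : Word A :=
  E.flatMap fun p => if p.2 then p.1 else FreeGroup.invRev p.1

theorem mk_substWord (E : List (Word A × Bool)) :
    FreeGroup.mk (substWord E) =
      FreeGroup.lift (fun w : Word A => FreeGroup.mk w) (FreeGroup.mk E) := by
  rw [FreeGroup.lift_mk]
  induction E with
  | nil => rfl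
  | cons p E ih =>
    rw [List.map_cons, List.prod_cons, ← ih]
    obtain ⟨w, _ | _⟩ := p <;> simp [substWord, FreeGroup.inv_mk, FreeGroup.mul_mk]

/-- The list `E` of signed generators is the certificate for membership. -/
theorem mem_gen_iff {W : List (Word A)} {g : FreeGroup A} :
    g ∈ gen W ↔ ∃ E : List (Word A × Bool), (∀ p ∈ E, p.1 ∈ W) ∧ FreeGroup.mk (substWord E) = g := by
  constructor
  · intro hg
    induction hg using Subgroup.closure_induction with
    | mem g hg =>
      obtain ⟨w, hw, rfl⟩ := hg
      exact ⟨[(w, true)], by simpa using hw, by simp [substWord]⟩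
    | one => exact ⟨[], by simp, rfl⟩
    | mul g h _ _ ihg ihh =>
      obtain ⟨E, hE, rfl⟩ := ihg
      obtain ⟨E', hE', rfl⟩ := ihh
      refine ⟨E ++ E', fun p hp => ?_, by simp [substWord, FreeGroup.mul_mk]⟩
      rcases List.mem_append.1 hp with hp | hp
      exacts [hE p hp, hE' p hp]
    | inv g _ ih =>
      obtain ⟨E, hE, rfl⟩ := ih
      refine ⟨FreeGroup.invRev E, fun p hp => ?_, ?_⟩
      · simp only [FreeGroup.invRev, List.mem_reverse, List.mem_map] at hp
        obtain ⟨q, hq, rfl⟩ := hp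
        exact hE q hq
      · rw [mk_substWord, mk_substWord, ← FreeGroup.inv_mk, map_inv]
  · rintro ⟨E, hE, rfl⟩
    rw [mk_substWord, FreeGroup.lift_mk]
    refine Subgroup.list_prod_mem _ fun x hx => ?_
    obtain ⟨⟨w, ε⟩, hp, rfl⟩ := List.mem_map.1 hx
    have := mk_mem_gen (hE _ hp)
    cases ε
    exacts [inv_mem this, this]

/-- The permutation of `ℕ` which is the product of a list of transpositions. -/
def swapList (l : List (ℕ × ℕ)) : Equiv.Perm ℕ := (l.map fun p => Equiv.swap p.1 p.2).prod

/-- Evaluation of a product of transpositions. -/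
def applySwaps (l : List (ℕ × ℕ)) (i : ℕ) : ℕ :=
  l.foldr (fun p y => if y = p.1 then p.2 else if y = p.2 then p.1 else y) i

theorem applySwaps_eq (l : List (ℕ × ℕ)) (i : ℕ) : applySwaps l i = swapList l i := by
  induction l with
  | nil => rfl
  | cons p l ih =>
    have hmul : swapList (p :: l) = Equiv.swap p.1 p.2 * swapList l := by simp [swapList]
    rw [applySwaps, List.foldr_cons, ← applySwaps, ih, hmul, Equiv.Perm.mul_apply,
      Equiv.swap_apply_def]

theorem swapList_reverse (l : List (ℕ × ℕ)) : swapList l.reverse = (swapList l)⁻¹ := by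
  rw [swapList, swapList, List.prod_inv_reverse]
  simp [List.map_reverse, Function.comp_def]

/-- Every injection of a finite set of natural numbers is realised by a list of transpositions. -/
theorem exists_swapList (s : Finset ℕ) (f : ℕ → ℕ) (hf : Set.InjOn f s) :
    ∃ l, ∀ i ∈ s, swapList l i = f i := by
  induction s using Finset.induction_on with
  | empty => exact ⟨[], by simp⟩
  | insert x s hx ih =>
    obtain ⟨l, hl⟩ := ih (hf.mono (by simp))
    -- One more transposition corrects the value at `x`. It fixes the values already arranged, since
    -- `swapList l` and `f` are injective.
    refine ⟨(swapList l x, f x) :: l, fun i hi => ?_⟩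
    have hmul : swapList ((swapList l x, f x) :: l) = Equiv.swap (swapList l x) (f x) * swapList l :=
      by simp [swapList]
    rw [hmul, Equiv.Perm.mul_apply]
    rcases Finset.mem_insert.1 hi with rfl | hi'
    · simp
    · have hne : i ≠ x := fun h => hx (h ▸ hi')
      rw [Equiv.swap_apply_of_ne_of_ne, hl i hi']
      · exact fun h => hne ((swapList l).injective h)
      · rw [hl i hi']
        exact fun h => hne (hf (by simp [hi']) (by simp) h)

/-- The permutation representation in which the letter `a` acts through the `a`-th list of
transpositions. -/
def swapHom (c : List (List (ℕ × ℕ))) : FreeGroup ℕ →* Equiv.Perm ℕ :=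
  FreeGroup.lift fun a => swapList (c.getD a [])

/-- Evaluation of a word in the representation `swapHom c`. -/
def runSwaps (c : List (List (ℕ × ℕ))) (w : Word ℕ) (i : ℕ) : ℕ :=
  w.foldr (fun x j => applySwaps
    (if x.2 = true then c.getD x.1 [] else (c.getD x.1 []).reverse) j) i

theorem runSwaps_eq (c : List (List (ℕ × ℕ))) (w : Word ℕ) (i : ℕ) :
    runSwaps c w i = swapHom c (FreeGroup.mk w) i := by
  induction w with
  | nil => simp [runSwaps, ← FreeGroup.one_eq_mk]
  | cons x w ih =>
    rw [runSwaps, List.foldr_cons, ← runSwaps, ih, mk_cons, map_mul, Equiv.Perm.mul_apply,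
      applySwaps_eq]
    obtain ⟨a, _ | _⟩ := x
    · rw [mk_singleton_false, map_inv]
      simp [swapHom, swapList_reverse]
    · rw [mk_singleton_true]
      simp [swapHom]

theorem primrec_applySwaps : Primrec₂ applySwaps := by
  refine Primrec.list_foldr
    (h := fun (_ : List (ℕ × ℕ) × ℕ) (q : (ℕ × ℕ) × ℕ) =>
      if q.2 = q.1.1 then q.1.2 else if q.2 = q.1.2 then q.1.1 else q.2)
    Primrec.fst Primrec.snd ?_
  have hy : Primrec fun t : (List (ℕ × ℕ) × ℕ) × (ℕ × ℕ) × ℕ => t.2.2 :=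
    Primrec.snd.comp Primrec.snd
  have h1 : Primrec fun t : (List (ℕ × ℕ) × ℕ) × (ℕ × ℕ) × ℕ => t.2.1.1 :=
    Primrec.fst.comp (Primrec.fst.comp Primrec.snd)
  have h2 : Primrec fun t : (List (ℕ × ℕ) × ℕ) × (ℕ × ℕ) × ℕ => t.2.1.2 :=
    Primrec.snd.comp (Primrec.fst.comp Primrec.snd)
  exact Primrec.ite (Primrec.eq.comp hy h1) h2 (Primrec.ite (Primrec.eq.comp hy h2) h1 hy)

theorem primrec_runSwaps :
    Primrec fun t : (List (List (ℕ × ℕ)) × Word ℕ) × ℕ => runSwaps t.1.1 t.1.2 t.2 := by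
  refine Primrec.list_foldr
    (h := fun (t : (List (List (ℕ × ℕ)) × Word ℕ) × ℕ) (q : (ℕ × Bool) × ℕ) => applySwaps
      (if q.1.2 = true then t.1.1.getD q.1.1 [] else (t.1.1.getD q.1.1 []).reverse) q.2)
    (Primrec.snd.comp Primrec.fst) Primrec.snd ?_
  have hl : Primrec fun r : ((List (List (ℕ × ℕ)) × Word ℕ) × ℕ) × (ℕ × Bool) × ℕ =>
      r.1.1.1.getD r.2.1.1 [] :=
    (Primrec.list_getD []).comp (Primrec.fst.comp (Primrec.fst.comp Primrec.fst))
      (Primrec.fst.comp (Primrec.fst.comp Primrec.snd))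
  exact primrec_applySwaps.comp
    (Primrec.ite (Primrec.eq.comp (Primrec.snd.comp (Primrec.fst.comp Primrec.snd))
      (Primrec.const true)) hl (Primrec.list_reverse.comp hl)) (Primrec.snd.comp Primrec.snd)

theorem exists_letter_bound (W : List (Word ℕ)) : ∃ N, ∀ w ∈ W, ∀ x ∈ w, x.1 < N := by
  refine ⟨((W.flatMap fun w => w.map Prod.fst).foldr max 0) + 1, fun w hw x hx => ?_⟩
  refine Nat.lt_succ_of_le ?_
  have hmem : x.1 ∈ W.flatMap fun w => w.map Prod.fst :=
    List.mem_flatMap.2 ⟨w, hw, List.mem_map_of_mem hx⟩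
  generalize (W.flatMap fun w => w.map Prod.fst) = l at hmem
  induction l with
  | nil => simp at hmem
  | cons b l ih =>
    rcases List.mem_cons.1 hmem with h | h
    · simp [h]
    · exact (ih h).trans (by simp)

theorem getD_map_range {β : Type*} (f : ℕ → β) (d : β) {N a : ℕ} (ha : a < N) :
    ((List.range N).map f).getD a d = f a := by
  simp [List.getD, ha]

/-- Finitely generated subgroups of a free group are separated from elements outside by actions on
finite sets. -/
theorem notMem_gen_iff {W : List (Word ℕ)} {u : Word ℕ} :
    FreeGroup.mk u ∉ gen W ↔ ∃ c : List (List (ℕ × ℕ)) × ℕ,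
      (∀ w ∈ W, runSwaps c.1 w c.2 = c.2) ∧ ¬ runSwaps c.1 u c.2 = c.2 := by
  constructor
  · intro hu
    have : Countable (FreeGroup ℕ) :=
      Function.Surjective.countable (f := (FreeGroup.mk : Word ℕ → _)) Quot.mk_surjective
    have : Countable (FreeGroup ℕ ⧸ gen W) := Quotient.countable
    -- The cosets, possibly infinitely many, are numbered by `e`. The set `V` below holds the
    -- finitely many cosets visited when the given words are read from the right, starting at the
    -- trivial coset.
    obtain ⟨e, he⟩ := exists_injective_nat (FreeGroup ℕ ⧸ gen W)
    let pt : Word ℕ → FreeGroup ℕ ⧸ gen W := fun s => (FreeGroup.mk s : FreeGroup ℕ ⧸ gen W)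
    let V : Finset ℕ := ((u :: W).flatMap fun v => v.tails.map fun s => e (pt s)).toFinset
    let f : ℕ → ℕ → ℕ := fun a i => e (FreeGroup.of a • Function.invFun e i)
    have hV : ∀ i ∈ V, ∃ x, e x = i := fun i hi => by
      simp only [V, List.mem_toFinset, List.mem_flatMap, List.mem_map] at hi
      obtain ⟨_, _, s, _, rfl⟩ := hi
      exact ⟨_, rfl⟩
    have hf : ∀ a, Set.InjOn (f a) V := fun a i hi j hj hij => by
      obtain ⟨x, rfl⟩ := hV i hi
      obtain ⟨y, rfl⟩ := hV j hj
      have := he hij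
      rw [Function.leftInverse_invFun he, Function.leftInverse_invFun he] at this
      rw [smul_left_cancel _ this]
    -- Each letter acts injectively on `V`, so its action there extends to a product of
    -- transpositions.
    choose l hl using fun a => exists_swapList V (f a) (hf a)
    obtain ⟨N, hN⟩ := exists_letter_bound (u :: W)
    have hrun : ∀ v ∈ u :: W, ∀ s, s <:+ v →
        runSwaps ((List.range N).map l) s (e (pt [])) = e (pt s) := by
      intro v hv s hs
      have hmem : ∀ s, s <:+ v → e (pt s) ∈ V := fun s hs => by
        simp only [V, List.mem_toFinset, List.mem_flatMap, List.mem_map, List.mem_tails]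
        exact ⟨v, hv, s, hs, rfl⟩
      induction s with
      | nil => rfl
      | cons x s ih =>
        have hs' : s <:+ v := (List.suffix_cons x s).trans hs
        have hx : x.1 < N := hN v hv x (hs.subset (by simp))
        rw [runSwaps_eq, mk_cons, map_mul, Equiv.Perm.mul_apply, ← runSwaps_eq _ s, ih hs']
        have hstep : ∀ s, s <:+ v →
            swapHom ((List.range N).map l) (FreeGroup.of x.1) (e (pt s)) =
              e (FreeGroup.of x.1 • pt s) := fun s hs => by
          rw [swapHom, FreeGroup.lift_apply_of, getD_map_range _ _ hx, hl _ _ (hmem s hs)]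
          simp only [f, Function.leftInverse_invFun he _]
        have hpt : pt (x :: s) = FreeGroup.mk [x] • pt s := by
          simp only [pt]
          rw [mk_cons]
          rfl
        obtain ⟨a, _ | _⟩ := x
        · rw [mk_singleton_false] at hpt ⊢
          -- For an inverse letter, `a` leads from the new point back to the old one, so its action
          -- must be prescribed at the new point, which is also in `V`.
          rw [map_inv, Equiv.Perm.inv_eq_iff_eq, hstep _ hs, hpt, smul_inv_smul]
        · rw [mk_singleton_true] at hpt ⊢
          rw [hstep _ hs', hpt]
    have hpt : ∀ w, e (pt w) = e (pt []) ↔ FreeGroup.mk w ∈ gen W := fun w => by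
      rw [he.eq_iff]
      simp only [pt]
      rw [← FreeGroup.one_eq_mk, eq_comm, QuotientGroup.eq]
      simp
    refine ⟨⟨(List.range N).map l, e (pt [])⟩, fun w hw => ?_, ?_⟩
    · rw [hrun w (by simp [hw]) w List.suffix_rfl, hpt]
      exact mk_mem_gen hw
    · rw [hrun u (by simp) u List.suffix_rfl, hpt]
      exact hu
  -- Conversely, the stabilizer of the point contains the generators, hence `gen W`.
  · rintro ⟨⟨c, o⟩, hW, hu⟩ hmem
    have hle : gen W ≤ (MulAction.stabilizer (Equiv.Perm ℕ) o).comap (swapHom c) :=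
      (gen_le_iff _ _).2 fun w hw => by
        have := hW w hw
        rwa [runSwaps_eq] at this
    refine hu ?_
    rw [runSwaps_eq]
    exact hle hmem

theorem primrec_substWord : Primrec (substWord : List (Word ℕ × Bool) → Word ℕ) :=
  Primrec.list_flatMap (g := fun (_ : List (Word ℕ × Bool)) (p : Word ℕ × Bool) =>
      if p.2 = true then p.1 else FreeGroup.invRev p.1) Primrec.id
    (Primrec.ite (Primrec.eq.comp (Primrec.snd.comp Primrec.snd) (Primrec.const true))
      (Primrec.fst.comp Primrec.snd) (primrec_invRev.comp (Primrec.fst.comp Primrec.snd)))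

section

variable {α : Type*} [Primcodable α]

theorem computablePred_runSwaps {c : α → List (List (ℕ × ℕ)) × ℕ} {w : α → Word ℕ}
    (hc : Computable c) (hw : Computable w) :
    ComputablePred fun a => runSwaps (c a).1 (w a) (c a).2 = (c a).2 :=
  ComputablePred.eq (primrec_runSwaps.to_comp.comp
    (((Computable.fst.comp hc).pair hw).pair (Computable.snd.comp hc))) (Computable.snd.comp hc)

theorem computablePred_substWord {E : α → List (Word ℕ × Bool)} {W : α → List (Word ℕ)}
    {u : α → Word ℕ} (hE : Computable E) (hW : Computable W) (hu : Computable u) :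
    ComputablePred fun a => (∀ q ∈ E a, q.1 ∈ W a) ∧
      FreeGroup.reduce (substWord (E a)) = FreeGroup.reduce (u a) := by
  refine ComputablePred.and ?_ ?_
  · exact ComputablePred.forall_mem_list (p := fun a (q : Word ℕ × Bool) => q.1 ∈ W a)
      (computablePred_mem (Computable.fst.comp Computable.snd) (hW.comp Computable.fst)) hE
  · exact ComputablePred.eq (primrec_reduce.to_comp.comp (primrec_substWord.to_comp.comp hE))
      (primrec_reduce.to_comp.comp hu)

/-- The certificates are a product of generators, compared with the word after reduction, and a
finitary permutation action in which the generators fix a point that the word moves. -/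
theorem computablePred_mem_gen {W : α → List (Word ℕ)} {u : α → Word ℕ} (hW : Computable W)
    (hu : Computable u) : ComputablePred fun a => FreeGroup.mk (u a) ∈ gen (W a) := by
  refine ComputablePred.of_certificates
    (R := fun a (E : List (Word ℕ × Bool)) => (∀ q ∈ E, q.1 ∈ W a) ∧
      FreeGroup.reduce (substWord E) = FreeGroup.reduce (u a))
    (R' := fun a (c : List (List (ℕ × ℕ)) × ℕ) =>
      (∀ w ∈ W a, runSwaps c.1 w c.2 = c.2) ∧ ¬ runSwaps c.1 (u a) c.2 = c.2) ?_ ?_ ?_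
    fun a => notMem_gen_iff
  · exact computablePred_substWord Computable.snd (hW.comp Computable.fst)
      (hu.comp Computable.fst)
  · refine ComputablePred.and ?_ (ComputablePred.not ?_)
    · exact ComputablePred.forall_mem_list
        (p := fun (a : α × List (List (ℕ × ℕ)) × ℕ) (w : Word ℕ) => runSwaps a.2.1 w a.2.2 = a.2.2)
        (computablePred_runSwaps (Computable.snd.comp Computable.fst) Computable.snd)
        (hW.comp Computable.fst)
    · exact computablePred_runSwaps Computable.snd (hu.comp Computable.fst)
  · intro a
    rw [mem_gen_iff]
    refine exists_congr fun E => and_congr_right fun _ => ?_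
    rw [← FreeGroup.toWord_mk, ← FreeGroup.toWord_mk, FreeGroup.toWord_inj]

end

end Membership

/-! ### Membership in `HF'` and torsion modulo `HF'` -/

section AbelianMembership

/-- A word for the commutator of two words. -/
def commWord (p : Word A × Word A) : Word A :=
  p.1 ++ (p.2 ++ (FreeGroup.invRev p.1 ++ FreeGroup.invRev p.2))

theorem mk_commWord (p : Word A × Word A) :
    FreeGroup.mk (commWord p) = ⁅FreeGroup.mk p.1, FreeGroup.mk p.2⁆ := by
  simp [commWord, commutatorElement_def, FreeGroup.inv_mk, FreeGroup.mul_mk]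

/-- An element of `HF'` involves only finitely many commutators, so membership is certified by
adjoining these to `W`. -/
theorem mem_gen_sup_commutator_iff {W : List (Word A)} {g : FreeGroup A} :
    g ∈ gen W ⊔ commutator (FreeGroup A) ↔
      ∃ C : List (Word A × Word A), g ∈ gen (W ++ C.map commWord) := by
  classical
  constructor
  · intro hg
    have hcl : gen W ⊔ commutator (FreeGroup A) =
        Subgroup.closure ({g | ∃ w ∈ W, FreeGroup.mk w = g} ∪ commutatorSet (FreeGroup A)) := by
      rw [Subgroup.closure_union, commutator_eq_closure]
      rfl
    rw [hcl] at hg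
    induction hg using Subgroup.closure_induction with
    | mem g hg =>
      rcases hg with ⟨w, hw, rfl⟩ | ⟨x, y, rfl⟩
      · exact ⟨[], mk_mem_gen (by simp [hw])⟩
      · refine ⟨[(x.toWord, y.toWord)], ?_⟩
        have : FreeGroup.mk (commWord (x.toWord, y.toWord)) ∈
          gen (W ++ [(x.toWord, y.toWord)].map commWord) := mk_mem_gen (by simp)
        rwa [mk_commWord, FreeGroup.mk_toWord, FreeGroup.mk_toWord] at this
    | one => exact ⟨[], one_mem _⟩
    | mul g h _ _ ihg ihh =>
      obtain ⟨C, hC⟩ := ihg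
      obtain ⟨C', hC'⟩ := ihh
      refine ⟨C ++ C', mul_mem (gen_mono (fun w hw => ?_) hC) (gen_mono (fun w hw => ?_) hC')⟩ <;>
      · simp only [List.map_append, List.mem_append] at hw ⊢
        tauto
    | inv g _ ih =>
      obtain ⟨C, hC⟩ := ih
      exact ⟨C, inv_mem hC⟩
  · rintro ⟨C, hC⟩
    refine (gen_le_iff _ _).2 (fun w hw => ?_) hC
    rcases List.mem_append.1 hw with hw | hw
    · exact le_sup_left (a := gen W) (mk_mem_gen hw)
    · obtain ⟨p, -, rfl⟩ := List.mem_map.1 hw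
      rw [mk_commWord]
      exact le_sup_right (a := gen W) (Subgroup.commutator_mem_commutator trivial trivial)

/-- The sum over a word of the entries of `p` at positive letters and of `q` at negative ones. -/
def evalPair (p q : List ℕ) (w : Word ℕ) : ℕ :=
  w.foldr (fun x s => (if x.2 = true then p.getD x.1 0 else q.getD x.1 0) + s) 0

theorem primrec_evalPair :
    Primrec fun t : (List ℕ × List ℕ) × Word ℕ => evalPair t.1.1 t.1.2 t.2 := by
  refine Primrec.list_foldr
    (h := fun (t : (List ℕ × List ℕ) × Word ℕ) (y : (ℕ × Bool) × ℕ) =>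
      (if y.1.2 = true then t.1.1.getD y.1.1 0 else t.1.2.getD y.1.1 0) + y.2)
    Primrec.snd (Primrec.const 0) ?_
  have ha : Primrec fun r : ((List ℕ × List ℕ) × Word ℕ) × (ℕ × Bool) × ℕ => r.2.1.1 :=
    Primrec.fst.comp (Primrec.fst.comp Primrec.snd)
  exact Primrec.nat_add.comp (Primrec.ite
    (Primrec.eq.comp (Primrec.snd.comp (Primrec.fst.comp Primrec.snd)) (Primrec.const true))
    ((Primrec.list_getD 0).comp (Primrec.fst.comp (Primrec.fst.comp Primrec.fst)) ha)
    ((Primrec.list_getD 0).comp (Primrec.snd.comp (Primrec.fst.comp Primrec.fst)) ha))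
    (Primrec.snd.comp Primrec.snd)

/-- Integral weights are coded as differences of natural numbers, so that evaluation stays in `ℕ`;
an inverse letter exchanges the roles of `p` and `q`. -/
theorem wt_getD (p q : List ℕ) (w : Word ℕ) :
    (wt (fun a => (p.getD a 0 : ℤ) - q.getD a 0) (FreeGroup.mk w)).toAdd =
      (evalPair p q w : ℤ) - evalPair q p w := by
  induction w with
  | nil => simp [evalPair, ← FreeGroup.one_eq_mk]
  | cons x w ih =>
    rw [mk_cons, map_mul, toAdd_mul, ih]
    obtain ⟨a, _ | _⟩ := x
    · rw [mk_singleton_false, map_inv, toAdd_inv, wt_of, toAdd_ofAdd]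
      simp only [evalPair, List.foldr_cons, Bool.false_eq_true, if_false]
      push_cast
      ring
    · rw [mk_singleton_true, wt_of, toAdd_ofAdd]
      simp only [evalPair, List.foldr_cons, if_true]
      push_cast
      ring

theorem dvd_wt_iff (m : ℕ) (p q : List ℕ) (w : Word ℕ) :
    (m : ℤ) ∣ (wt (fun a => (p.getD a 0 : ℤ) - q.getD a 0) (FreeGroup.mk w)).toAdd ↔
      evalPair p q w % m = evalPair q p w % m := by
  rw [wt_getD, ← Int.modEq_iff_dvd, Int.natCast_modEq_iff]
  exact eq_comm

/-- On finitely many words, integral functionals are given by finite data. -/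
theorem exists_lists_wt (z : ℕ → ℤ) (W : List (Word ℕ)) : ∃ p q : List ℕ, ∀ w ∈ W,
    wt (fun a => (p.getD a 0 : ℤ) - q.getD a 0) (FreeGroup.mk w) = wt z (FreeGroup.mk w) := by
  obtain ⟨N, hN⟩ := exists_letter_bound W
  refine ⟨(List.range N).map fun a => (z a).toNat, (List.range N).map fun a => (-z a).toNat,
    fun w hw => hom_mk_congr fun x hx => ?_⟩
  have hx := hN w hw x hx
  rw [wt_of, wt_of, getD_map_range _ _ hx, getD_map_range _ _ hx, Int.toNat_sub_toNat_neg]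

/-- The certificate is a modulus with a coded weight, as provided by `exists_wt_not_dvd`. Modulus
`0` is also sound: the congruences are then equalities. -/
theorem notMem_gen_sup_commutator_iff {W : List (Word ℕ)} {u : Word ℕ} :
    FreeGroup.mk u ∉ gen W ⊔ commutator (FreeGroup ℕ) ↔ ∃ c : ℕ × List ℕ × List ℕ,
      (∀ w ∈ W, evalPair c.2.1 c.2.2 w % c.1 = evalPair c.2.2 c.2.1 w % c.1) ∧
      ¬ evalPair c.2.1 c.2.2 u % c.1 = evalPair c.2.2 c.2.1 u % c.1 := by
  constructor
  · intro hu
    obtain ⟨m, -, z, hz, hzu⟩ := exists_wt_not_dvd W hu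
    obtain ⟨p, q, hpq⟩ := exists_lists_wt z (u :: W)
    refine ⟨⟨m, p, q⟩, fun w hw => ?_, ?_⟩
    · rw [← dvd_wt_iff, hpq w (by simp [hw])]
      exact hz w hw
    · rw [← dvd_wt_iff, hpq u (by simp)]
      exact hzu
  · rintro ⟨⟨m, p, q⟩, hW, hu⟩ hmem
    exact hu ((dvd_wt_iff _ _ _ _).1
      (wt_gen_sup_commutator W (fun w hw => (dvd_wt_iff _ _ _ _).2 (hW w hw)) hmem))

theorem computable_evalPair {α : Type*} [Primcodable α] {p q : α → List ℕ} {w : α → Word ℕ}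
    (hp : Computable p) (hq : Computable q) (hw : Computable w) :
    Computable fun a => evalPair (p a) (q a) (w a) :=
  primrec_evalPair.to_comp.comp ((hp.pair hq).pair hw)

theorem primrec_commWord : Primrec (commWord : Word ℕ × Word ℕ → Word ℕ) :=
  Primrec.list_append.comp Primrec.fst (Primrec.list_append.comp Primrec.snd
    (Primrec.list_append.comp (primrec_invRev.comp Primrec.fst) (primrec_invRev.comp Primrec.snd)))

theorem computablePred_evalPair {α : Type*} [Primcodable α] {c : α → ℕ × List ℕ × List ℕ}
    {w : α → Word ℕ} (hc : Computable c) (hw : Computable w) : ComputablePred fun a =>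
      evalPair (c a).2.1 (c a).2.2 (w a) % (c a).1 =
        evalPair (c a).2.2 (c a).2.1 (w a) % (c a).1 := by
  have h1 := Computable.fst.comp (Computable.snd.comp hc)
  have h2 := Computable.snd.comp (Computable.snd.comp hc)
  exact ComputablePred.eq
    (Primrec.nat_mod.to_comp.comp (computable_evalPair h1 h2 hw) (Computable.fst.comp hc))
    (Primrec.nat_mod.to_comp.comp (computable_evalPair h2 h1 hw) (Computable.fst.comp hc))

theorem computablePred_mem_gen_sup_commutator {α : Type*} [Primcodable α]
    {W : α → List (Word ℕ)} {u : α → Word ℕ} (hW : Computable W) (hu : Computable u) :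
    ComputablePred fun a => FreeGroup.mk (u a) ∈ gen (W a) ⊔ commutator (FreeGroup ℕ) := by
  refine ComputablePred.of_certificates
    (R := fun a (C : List (Word ℕ × Word ℕ)) =>
      FreeGroup.mk (u a) ∈ gen (W a ++ C.map commWord))
    (R' := fun a (c : ℕ × List ℕ × List ℕ) =>
      (∀ w ∈ W a, evalPair c.2.1 c.2.2 w % c.1 = evalPair c.2.2 c.2.1 w % c.1) ∧
      ¬ evalPair c.2.1 c.2.2 (u a) % c.1 = evalPair c.2.2 c.2.1 (u a) % c.1) ?_ ?_
    (fun a => mem_gen_sup_commutator_iff) fun a => notMem_gen_sup_commutator_iff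
  · refine computablePred_mem_gen ?_ (hu.comp Computable.fst)
    exact Computable.list_append.comp (hW.comp Computable.fst)
      (Computable.list_map Computable.snd (primrec_commWord.to_comp.comp Computable.snd).to₂)
  · refine ComputablePred.and ?_ (ComputablePred.not ?_)
    · exact ComputablePred.forall_mem_list
        (p := fun (a : α × ℕ × List ℕ × List ℕ) (w : Word ℕ) =>
          evalPair a.2.2.1 a.2.2.2 w % a.2.1 = evalPair a.2.2.2 a.2.2.1 w % a.2.1)
        (computablePred_evalPair (Computable.snd.comp Computable.fst) Computable.snd)
        (hW.comp Computable.fst)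
    · exact computablePred_evalPair Computable.snd (hu.comp Computable.fst)

/-- A word for a power of a letter. -/
def powWord (a : A) (m : ℕ) : Word A := (List.range m).map fun _ => (a, true)

theorem mk_powWord (a : A) (m : ℕ) : FreeGroup.mk (powWord a m) = FreeGroup.of a ^ m := by
  rw [← mk_singleton_true, FreeGroup.pow_mk]
  simp [powWord]

/-- The product of the individual exponents serves all letters, so a single number is a certificate.
-/
theorem forall_pow_mem_iff {K : Subgroup (FreeGroup ℕ)} {n : ℕ} :
    (∃ m : ℕ, 0 < m ∧ ∀ a < n, FreeGroup.of a ^ m ∈ K) ↔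
      ∀ a < n, ∃ m : ℕ, 0 < m ∧ FreeGroup.of a ^ m ∈ K := by
  refine ⟨fun ⟨m, hm, h⟩ a ha => ⟨m, hm, h a ha⟩, fun h => ?_⟩
  choose! m hm h using h
  refine ⟨∏ a ∈ Finset.range n, m a,
    Finset.prod_pos fun a ha => hm a (Finset.mem_range.1 ha), fun a ha => ?_⟩
  obtain ⟨k, hk⟩ := Finset.dvd_prod_of_mem m (Finset.mem_range.2 ha)
  rw [hk, pow_mul]
  exact pow_mem (h a ha) k

/-- A weight that vanishes on `W` vanishes on everything that is torsion modulo `HF'`; by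
`exists_wt_eq_zero` such weights detect every letter of infinite order. -/
theorem not_forall_pow_mem_iff {W : List (Word ℕ)} {n : ℕ} :
    (¬ ∃ m : ℕ, 0 < m ∧ ∀ a < n, FreeGroup.of a ^ m ∈ gen W ⊔ commutator (FreeGroup ℕ)) ↔
      ∃ c : List ℕ × List ℕ, (∀ w ∈ W, evalPair c.1 c.2 w = evalPair c.2 c.1 w) ∧
        ¬ ∀ a < n, c.1.getD a 0 = c.2.getD a 0 := by
  rw [forall_pow_mem_iff]
  have hwt : ∀ (p q : List ℕ) (w : Word ℕ),
      wt (fun a => (p.getD a 0 : ℤ) - q.getD a 0) (FreeGroup.mk w) = 1 ↔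
        evalPair p q w = evalPair q p w := fun p q w => by
    rw [← toAdd_eq_zero, wt_getD, sub_eq_zero, Nat.cast_inj]
  constructor
  · intro h
    push Not at h
    obtain ⟨a, ha, h⟩ := h
    obtain ⟨z, hz, hza⟩ := exists_wt_eq_zero W h
    obtain ⟨p, q, hpq⟩ := exists_lists_wt z ([(a, true)] :: W)
    refine ⟨⟨p, q⟩, fun w hw => ?_, fun hall => hza ?_⟩
    · rw [← hwt, hpq w (by simp [hw])]
      exact hz w hw
    · have h1 := congrArg Multiplicative.toAdd (hpq [(a, true)] (by simp))
      rw [mk_singleton_true, wt_of, wt_of, toAdd_ofAdd, toAdd_ofAdd] at h1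
      rw [← h1, hall a ha, sub_self]
  · rintro ⟨⟨p, q⟩, hW, hne⟩ h
    refine hne fun a ha => ?_
    obtain ⟨m, hm, hmem⟩ := h a ha
    have h1 := wt_gen_sup_commutator W (m := 0) (fun w hw => by
      rw [(hwt p q w).2 (hW w hw)]; simp) hmem
    rw [map_pow, wt_of] at h1
    have h2 : (p.getD a 0 : ℤ) - q.getD a 0 = 0 := by
      simpa only [Nat.cast_zero, zero_dvd_iff, toAdd_pow, toAdd_ofAdd, smul_eq_zero, hm.ne',
        false_or] using h1
    exact_mod_cast sub_eq_zero.1 h2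

theorem primrec_powWord : Primrec₂ (powWord : ℕ → ℕ → Word ℕ) :=
  Primrec.list_map (Primrec.list_range.comp Primrec.snd)
    (((Primrec.fst.comp Primrec.fst).pair (Primrec.const true)).to₂)

theorem computablePred_forall_pow_mem {α : Type*} [Primcodable α] {n : α → ℕ}
    {W : α → List (Word ℕ)} (hn : Computable n) (hW : Computable W) :
    ComputablePred fun a => ∃ m : ℕ, 0 < m ∧
      ∀ i < n a, FreeGroup.of i ^ m ∈ gen (W a) ⊔ commutator (FreeGroup ℕ) := by
  refine ComputablePred.of_certificates
    (R := fun a (m : ℕ) => 0 < m ∧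
      ∀ i < n a, FreeGroup.mk (powWord i m) ∈ gen (W a) ⊔ commutator (FreeGroup ℕ))
    (R' := fun a (c : List ℕ × List ℕ) =>
      (∀ w ∈ W a, evalPair c.1 c.2 w = evalPair c.2 c.1 w) ∧
        ¬ ∀ i < n a, c.1.getD i 0 = c.2.getD i 0) ?_ ?_
    (fun a => by simp only [mk_powWord]) fun a => not_forall_pow_mem_iff
  · refine ComputablePred.and (ComputablePred.lt (Computable.const 0) Computable.snd) ?_
    exact ComputablePred.forall_lt
      (p := fun (a : α × ℕ) (i : ℕ) =>
        FreeGroup.mk (powWord i a.2) ∈ gen (W a.1) ⊔ commutator (FreeGroup ℕ))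
      (computablePred_mem_gen_sup_commutator (hW.comp (Computable.fst.comp Computable.fst))
        (primrec_powWord.to_comp.comp Computable.snd (Computable.snd.comp Computable.fst)))
      (hn.comp Computable.fst)
  · have h1 : Computable fun t : (α × List ℕ × List ℕ) × Word ℕ => t.1.2.1 :=
      Computable.fst.comp (Computable.snd.comp Computable.fst)
    have h2 : Computable fun t : (α × List ℕ × List ℕ) × Word ℕ => t.1.2.2 :=
      Computable.snd.comp (Computable.snd.comp Computable.fst)
    have h1' : Computable fun t : (α × List ℕ × List ℕ) × ℕ => t.1.2.1 :=
      Computable.fst.comp (Computable.snd.comp Computable.fst)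
    have h2' : Computable fun t : (α × List ℕ × List ℕ) × ℕ => t.1.2.2 :=
      Computable.snd.comp (Computable.snd.comp Computable.fst)
    refine ComputablePred.and ?_ (ComputablePred.not ?_)
    · exact ComputablePred.forall_mem_list
        (p := fun (a : α × List ℕ × List ℕ) (w : Word ℕ) =>
          evalPair a.2.1 a.2.2 w = evalPair a.2.2 a.2.1 w)
        (ComputablePred.eq (computable_evalPair h1 h2 Computable.snd)
          (computable_evalPair h2 h1 Computable.snd)) (hW.comp Computable.fst)
    · exact ComputablePred.forall_lt
        (p := fun (a : α × List ℕ × List ℕ) (i : ℕ) => a.2.1.getD i 0 = a.2.2.getD i 0)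
        (ComputablePred.eq ((Primrec.list_getD 0).to_comp.comp h1' Computable.snd)
          ((Primrec.list_getD 0).to_comp.comp h2' Computable.snd)) (hn.comp Computable.fst)

end AbelianMembership

/-! ### Schreier generators form a basis; the rewriting process -/

section Schreier

/-- `r` selects a representative word for each left coset of `K`, and the set of selected words is
closed under deletion of the first letter. -/
structure IsSchreierRep (K : Subgroup (FreeGroup A)) (r : Word A → Word A) : Prop where
  mem : ∀ w, (FreeGroup.mk (r w))⁻¹ * FreeGroup.mk w ∈ K
  eq_of_mem : ∀ w w', (FreeGroup.mk w)⁻¹ * FreeGroup.mk w' ∈ K → r w = r w'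
  nil : r [] = []
  tail : ∀ x t, r (x :: t) = x :: t → r t = t

/-- The Schreier generator for the letter `a` and the representative `t`, as a word. -/
def edgeWord (r : Word A → Word A) (a : A) (t : Word A) : Word A :=
  FreeGroup.invRev (r ((a, true) :: t)) ++ (a, true) :: t

/-- The edge from `t` labelled `a` belongs to the tree spanned by the representatives. -/
def IsTreeEdge (r : Word A → Word A) (a : A) (t : Word A) : Prop :=
  r ((a, true) :: t) = (a, true) :: t ∨ t = (a, false) :: r ((a, true) :: t)

/-- The edges outside the spanning tree. -/
def SchreierEdge (r : Word A → Word A) : Type u :=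
  {p : A × Word A // r p.2 = p.2 ∧ ¬ IsTreeEdge r p.1 p.2}

/-- The words for the nontrivial Schreier generators. -/
def schreierWords (r : Word A → Word A) : Set (Word A) :=
  {w | ∃ a t, r t = t ∧ ¬ IsTreeEdge r a t ∧ edgeWord r a t = w}

open Classical in
/-- The free generator attached to an edge; it is trivial for edges of the tree. -/
noncomputable def edgeGen (r : Word A → Word A) (a : A) (t : Word A) :
    FreeGroup (SchreierEdge r) :=
  if h : r t = t ∧ ¬ IsTreeEdge r a t then FreeGroup.of ⟨(a, t), h⟩ else 1

/-- Evaluation of the free generators attached to the edges. -/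
def edgeHom (r : Word A → Word A) : FreeGroup (SchreierEdge r) →* FreeGroup A :=
  FreeGroup.lift fun p => FreeGroup.mk (edgeWord r p.1.1 p.1.2)

theorem mk_edgeWord (r : Word A → Word A) (a : A) (t : Word A) :
    FreeGroup.mk (edgeWord r a t) =
      (FreeGroup.mk (r ((a, true) :: t)))⁻¹ * (FreeGroup.of a * FreeGroup.mk t) := by
  rw [edgeWord, ← FreeGroup.mul_mk, ← FreeGroup.inv_mk, mk_cons, mk_singleton_true]

theorem IsTreeEdge.mk_edgeWord_eq_one {r : Word A → Word A} {a : A} {t : Word A}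
    (h : IsTreeEdge r a t) : FreeGroup.mk (edgeWord r a t) = 1 := by
  rw [mk_edgeWord]
  rcases h with h | h
  · rw [h, mk_cons, mk_singleton_true, inv_mul_cancel]
  · have h' : FreeGroup.mk t = (FreeGroup.of a)⁻¹ * FreeGroup.mk (r ((a, true) :: t)) := by
      conv_lhs => rw [h]
      rw [mk_cons, mk_singleton_false]
    rw [h', mul_inv_cancel_left, inv_mul_cancel]

theorem edgeHom_edgeGen {r : Word A → Word A} {a : A} {t : Word A} (ht : r t = t) :
    edgeHom r (edgeGen r a t) = FreeGroup.mk (edgeWord r a t) := by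
  rw [edgeGen]
  split_ifs with h
  · exact FreeGroup.lift_apply_of
  · rw [map_one, IsTreeEdge.mk_edgeWord_eq_one]
    by_contra hn
    exact h ⟨ht, hn⟩

theorem edgeGen_eq_one {r : Word A → Word A} {a : A} {t : Word A} (h : IsTreeEdge r a t) :
    edgeGen r a t = 1 := by
  rw [edgeGen, dif_neg]
  tauto

variable {K : Subgroup (FreeGroup A)} {r : Word A → Word A}

namespace IsSchreierRep

theorem idem (h : IsSchreierRep K r) (w : Word A) : r (r w) = r w :=
  h.eq_of_mem _ _ (h.mem w)

theorem cons_rep (h : IsSchreierRep K r) (x : A × Bool) (w : Word A) :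
    r (x :: r w) = r (x :: w) := by
  refine h.eq_of_mem _ _ ?_
  rw [mk_cons, mk_cons x w, mul_inv_rev, mul_assoc, inv_mul_cancel_left]
  exact h.mem w

theorem congr_mk (h : IsSchreierRep K r) {w w' : Word A}
    (hw : FreeGroup.mk w = FreeGroup.mk w') : r w = r w' :=
  h.eq_of_mem _ _ (by rw [hw, inv_mul_cancel]; exact one_mem _)

theorem cancel (h : IsSchreierRep K r) (a : A) (ε : Bool) (w : Word A) :
    r ((a, ε) :: (a, !ε) :: w) = r w := by
  refine h.congr_mk ?_
  rw [mk_cons, mk_cons _ w]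
  cases ε <;> simp [mk_singleton_true, mk_singleton_false]

theorem eq_nil (h : IsSchreierRep K r) {t : Word A} (ht : r t = t) (hK : FreeGroup.mk t ∈ K) :
    t = [] := by
  rw [← ht, ← h.nil]
  refine (h.eq_of_mem _ _ ?_).symm
  rwa [← FreeGroup.one_eq_mk, inv_one, one_mul]

theorem mk_edgeWord_mem (h : IsSchreierRep K r) (a : A) (t : Word A) :
    FreeGroup.mk (edgeWord r a t) ∈ K := by
  have := h.mem ((a, true) :: t)
  rwa [mk_cons, mk_singleton_true, ← mk_edgeWord] at this

theorem edgeHom_mem (h : IsSchreierRep K r) (g : FreeGroup (SchreierEdge r)) :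
    edgeHom r g ∈ K := by
  have : (edgeHom r).range ≤ K := FreeGroup.range_lift_le (by
    rintro _ ⟨p, rfl⟩
    exact h.mk_edgeWord_mem _ _)
  exact this ⟨g, rfl⟩

/-- The action of a letter on pairs of a representative and an element of the free group on the
edges. -/
noncomputable def letterPerm (h : IsSchreierRep K r) (a : A) :
    Equiv.Perm ({t : Word A // r t = t} × FreeGroup (SchreierEdge r)) where
  -- The pair `(t, g)` stands for the product of `t` and the value of `g`. Since `a * t` is `r (a
  -- t)` times the Schreier generator of the edge, this is left multiplication by `a`.
  toFun p := (⟨r ((a, true) :: p.1), h.idem _⟩, edgeGen r a p.1 * p.2)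
  invFun p := (⟨r ((a, false) :: p.1), h.idem _⟩, (edgeGen r a (r ((a, false) :: p.1)))⁻¹ * p.2)
  left_inv := by
    rintro ⟨⟨t, ht⟩, g⟩
    have : r ((a, false) :: r ((a, true) :: t)) = t := by
      rw [h.cons_rep]
      exact (h.cancel a false t).trans ht
    simp [this]
  right_inv := by
    rintro ⟨⟨t, ht⟩, g⟩
    have : r ((a, true) :: r ((a, false) :: t)) = t := by
      rw [h.cons_rep]
      exact (h.cancel a true t).trans ht
    simp [this]

/-- The action of the free group on pairs of a representative and an element of the free group on
the edges. -/
noncomputable def action (h : IsSchreierRep K r) :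
    FreeGroup A →* Equiv.Perm ({t : Word A // r t = t} × FreeGroup (SchreierEdge r)) :=
  FreeGroup.lift h.letterPerm

@[simp] theorem action_of (h : IsSchreierRep K r) (a : A) :
    h.action (FreeGroup.of a) = h.letterPerm a := FreeGroup.lift_apply_of

theorem action_mul_right (h : IsSchreierRep K r) (g : FreeGroup A)
    (p : {t : Word A // r t = t} × FreeGroup (SchreierEdge r)) (k : FreeGroup (SchreierEdge r)) :
    h.action g (p.1, p.2 * k) = ((h.action g p).1, (h.action g p).2 * k) := by
  induction g using FreeGroup.induction_on generalizing p with
  | C1 => simp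
  | of a => simp [letterPerm, mul_assoc]
  | inv_of a _ => simp [letterPerm, mul_assoc, Equiv.Perm.inv_def]
  | mul g g' ih ih' => rw [map_mul, Equiv.Perm.mul_apply, Equiv.Perm.mul_apply, ih', ih]

/-- Under evaluation of pairs in the free group on `A`, the action becomes left multiplication. -/
theorem action_eval (h : IsSchreierRep K r) (g : FreeGroup A)
    (p : {t : Word A // r t = t} × FreeGroup (SchreierEdge r)) :
    FreeGroup.mk (h.action g p).1.1 * edgeHom r (h.action g p).2 =
      g * (FreeGroup.mk p.1.1 * edgeHom r p.2) := by
  have hletter : ∀ a (p : {t : Word A // r t = t} × FreeGroup (SchreierEdge r)),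
      FreeGroup.mk (h.letterPerm a p).1.1 * edgeHom r (h.letterPerm a p).2 =
        FreeGroup.of a * (FreeGroup.mk p.1.1 * edgeHom r p.2) := fun a p => by
    simp only [letterPerm, Equiv.coe_fn_mk, map_mul, edgeHom_edgeGen p.1.2, mk_edgeWord]
    group
  induction g using FreeGroup.induction_on generalizing p with
  | C1 => simp
  | of a => rw [action_of, hletter]
  | inv_of a _ =>
    have := hletter a ((h.letterPerm a)⁻¹ p)
    rw [← Equiv.Perm.mul_apply, mul_inv_cancel, Equiv.Perm.one_apply] at this
    rw [map_inv, action_of, this, inv_mul_cancel_left]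
  | mul g g' ih ih' => rw [map_mul, Equiv.Perm.mul_apply, ih, ih', mul_assoc]

/-- The pair of the empty word and the trivial element. -/
def base (h : IsSchreierRep K r) : {t : Word A // r t = t} × FreeGroup (SchreierEdge r) :=
  (⟨[], h.nil⟩, 1)

/-- All tails of a representative are representatives, so its path runs inside the tree and collects
no generator. -/
theorem action_rep (h : IsSchreierRep K r) (t : Word A) (ht : r t = t) :
    h.action (FreeGroup.mk t) h.base = (⟨t, ht⟩, 1) := by
  induction t with
  | nil => rw [← FreeGroup.one_eq_mk, map_one]; rfl
  | cons x t ih =>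
    have ht' := h.tail x t ht
    rw [mk_cons, map_mul, Equiv.Perm.mul_apply, ih ht']
    obtain ⟨a, _ | _⟩ := x
    · have h1 : r ((a, true) :: (a, false) :: t) = t := (h.cancel a true t).trans ht'
      rw [mk_singleton_false, map_inv, action_of, Equiv.Perm.inv_eq_iff_eq]
      simp [letterPerm, h1, edgeGen_eq_one (r := r) (a := a) (t := (a, false) :: t)
        (Or.inr (by rw [h1]))]
    · rw [mk_singleton_true, action_of]
      simp [letterPerm, ht, edgeGen_eq_one (r := r) (a := a) (t := t) (Or.inl ht)]

/-- By `action_eval` the representative reached lies in `K`, so it is the empty word. -/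
theorem action_fst_of_mem (h : IsSchreierRep K r) {g : FreeGroup A} (hg : g ∈ K) :
    (h.action g h.base).1 = ⟨[], h.nil⟩ := by
  have h1 := h.action_eval g h.base
  refine Subtype.ext (h.eq_nil (h.action g h.base).1.2 ?_)
  have h2 : FreeGroup.mk h.base.1.1 * edgeHom r h.base.2 = 1 := by
    simp [base, ← FreeGroup.one_eq_mk]
  rw [h2, mul_one] at h1
  rw [eq_mul_inv_of_mul_eq h1]
  exact mul_mem hg (inv_mem (h.edgeHom_mem _))

/-- The path runs through the tree to `t`, crosses the edge and returns through the tree, so it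
collects exactly the generator of the edge. This is what makes the Schreier generators free. -/
theorem action_edgeWord (h : IsSchreierRep K r) (p : SchreierEdge r) :
    (h.action (FreeGroup.mk (edgeWord r p.1.1 p.1.2)) h.base).2 = FreeGroup.of p := by
  obtain ⟨⟨a, t⟩, ht, hp⟩ := p
  have h1 : h.action (FreeGroup.of a * FreeGroup.mk t) h.base =
      (⟨r ((a, true) :: t), h.idem _⟩, FreeGroup.of ⟨(a, t), ht, hp⟩) := by
    rw [map_mul, Equiv.Perm.mul_apply, h.action_rep t ht, action_of]
    simp [letterPerm, edgeGen, ht, hp]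
  have h2 : h.action (FreeGroup.mk (r ((a, true) :: t)))
      (⟨[], h.nil⟩, FreeGroup.of ⟨(a, t), ht, hp⟩) =
      (⟨r ((a, true) :: t), h.idem _⟩, FreeGroup.of ⟨(a, t), ht, hp⟩) := by
    have := h.action_mul_right (FreeGroup.mk (r ((a, true) :: t))) h.base
      (FreeGroup.of ⟨(a, t), ht, hp⟩)
    rw [h.action_rep _ (h.idem _)] at this
    simpa [base] using this
  rw [mk_edgeWord, map_mul, Equiv.Perm.mul_apply, h1, ← h2, map_inv,
    ← Equiv.Perm.mul_apply, inv_mul_cancel, Equiv.Perm.one_apply]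

/-- The isomorphism of `K` with the free group on the edges outside the tree. -/
noncomputable def mulEquiv (h : IsSchreierRep K r) : K ≃* FreeGroup (SchreierEdge r) where
  toFun g := (h.action g h.base).2
  invFun g := ⟨edgeHom r g, h.edgeHom_mem g⟩
  map_mul' g g' := by
    have h1 : h.action g' h.base = (h.base.1, h.base.2 * (h.action g' h.base).2) :=
      Prod.ext (h.action_fst_of_mem g'.2) (one_mul _).symm
    rw [Subgroup.coe_mul, map_mul, Equiv.Perm.mul_apply, h1, h.action_mul_right]
    simp [base]
  left_inv g := by
    have h1 := h.action_eval g h.base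
    rw [h.action_fst_of_mem g.2] at h1
    refine Subtype.ext ?_
    simpa [base, ← FreeGroup.one_eq_mk] using h1
  right_inv g := by
    induction g using FreeGroup.induction_on with
    | C1 => simp [base]
    | of p =>
      simp only [edgeHom, FreeGroup.lift_apply_of]
      exact h.action_edgeWord p
    | inv_of p ih =>
      have hmem := h.edgeHom_mem (FreeGroup.of p)
      have h1 : h.action (edgeHom r (FreeGroup.of p)) h.base =
          (h.base.1, h.base.2 * FreeGroup.of p) :=
        Prod.ext (h.action_fst_of_mem hmem) (ih.trans (one_mul _).symm)
      have h2 := h.action_mul_right (edgeHom r (FreeGroup.of p))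
        (h.base.1, h.base.2 * FreeGroup.of p) (FreeGroup.of p)⁻¹
      have h3 : h.action (edgeHom r (FreeGroup.of p)) (h.base.1, (FreeGroup.of p)⁻¹) = h.base := by
        have h4 := h.action_mul_right (edgeHom r (FreeGroup.of p)) h.base (FreeGroup.of p)⁻¹
        rw [h1] at h4
        simpa [base] using h4
      have h4 : h.action (edgeHom r (FreeGroup.of p)⁻¹) h.base =
          (h.base.1, (FreeGroup.of p)⁻¹) := by
        rw [map_inv, map_inv, Equiv.Perm.inv_eq_iff_eq]
        exact h3.symm
      exact congrArg Prod.snd h4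
    | mul g g' ih ih' =>
      have h1 : h.action (edgeHom r g') h.base = (h.base.1, h.base.2 * g') :=
        Prod.ext (h.action_fst_of_mem (h.edgeHom_mem g')) (ih'.trans (one_mul _).symm)
      simp only at ih ⊢
      rw [map_mul, map_mul, Equiv.Perm.mul_apply, h1, h.action_mul_right, ih]

/-- The nontrivial Schreier generators form a basis, and distinct edges give distinct words. -/
theorem exists_basis (h : IsSchreierRep K r) :
    ∃ b : FreeGroupBasis (SchreierEdge r) K,
      ∀ p, (b p : FreeGroup A) = FreeGroup.mk (edgeWord r p.1.1 p.1.2) :=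
  ⟨⟨h.mulEquiv⟩, fun p => by
    change edgeHom r (FreeGroup.of p) = _
    simp [edgeHom]⟩

theorem edgeWord_injective (h : IsSchreierRep K r) :
    Function.Injective fun p : SchreierEdge r => edgeWord r p.1.1 p.1.2 := by
  intro p q hpq
  obtain ⟨b, hb⟩ := h.exists_basis
  refine b.injective (Subtype.ext ?_)
  rw [hb, hb]
  exact congrArg FreeGroup.mk hpq

theorem isBasisOf (h : IsSchreierRep K r) :
    IsBasisOf (fun w : schreierWords r => FreeGroup.mk (w : Word A)) K := by
  obtain ⟨b, hb⟩ := h.exists_basis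
  let e : SchreierEdge r ≃ schreierWords r := Equiv.ofBijective
    (fun p => ⟨edgeWord r p.1.1 p.1.2, p.1.1, p.1.2, p.2.1, p.2.2, rfl⟩)
    ⟨fun p q hpq => h.edgeWord_injective (congrArg Subtype.val hpq), by
      rintro ⟨_, a, t, ht, hp, rfl⟩
      exact ⟨⟨(a, t), ht, hp⟩, rfl⟩⟩
  refine ⟨b.reindex e, fun w => ?_⟩
  obtain ⟨p, rfl⟩ := e.surjective w
  rw [FreeGroupBasis.reindex_apply, Equiv.symm_apply_apply, hb]
  rfl

end IsSchreierRep

open Classical in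
/-- One step of the Reidemeister–Schreier rewriting process, which reads a word from the right. -/
noncomputable def rewriteStep (r : Word A → Word A) (x : A × Bool)
    (s : Word A × List (Word A × Bool)) : Word A × List (Word A × Bool) :=
  if IsTreeEdge r x.1 (if x.2 = true then s.1 else r (x :: s.1)) then (r (x :: s.1), s.2)
  else (r (x :: s.1),
    (edgeWord r x.1 (if x.2 = true then s.1 else r (x :: s.1)), x.2) :: s.2)

/-- The Reidemeister–Schreier rewriting process. -/
noncomputable def rewriteWord (r : Word A → Word A) (w : Word A) :
    Word A × List (Word A × Bool) :=
  w.foldr (rewriteStep r) ([], [])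

/-- The three clauses together are the invariant of the process: the current representative times
the value of the output is the part of the word already read. -/
theorem IsSchreierRep.rewriteWord_spec (h : IsSchreierRep K r) (w : Word A) :
    r (rewriteWord r w).1 = (rewriteWord r w).1 ∧
      (∀ p ∈ (rewriteWord r w).2, p.1 ∈ schreierWords r) ∧
      FreeGroup.mk (rewriteWord r w).1 *
        FreeGroup.lift (fun w : Word A => FreeGroup.mk w) (FreeGroup.mk (rewriteWord r w).2) =
          FreeGroup.mk w := by
  induction w with
  | nil => exact ⟨h.nil, by simp [rewriteWord], by
      simp [rewriteWord, ← FreeGroup.one_eq_mk]⟩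
  | cons x w ih =>
    have hstep : rewriteWord r (x :: w) = rewriteStep r x (rewriteWord r w) := rfl
    rw [hstep]
    generalize rewriteWord r w = s at ih
    obtain ⟨t, E⟩ := s
    obtain ⟨ht, hE, hval⟩ := ih
    simp only at ht hE hval
    obtain ⟨a, ε⟩ := x
    -- An inverse letter traverses an edge backwards, and that edge starts at the new
    -- representative.
    set t₁ : Word A := if ε = true then t else r ((a, ε) :: t) with ht₁
    have hrt₁ : r t₁ = t₁ := by
      rw [ht₁]; split_ifs
      exacts [ht, h.idem _]
    have hmk : FreeGroup.mk (r ((a, ε) :: t)) *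
        FreeGroup.lift (fun w : Word A => FreeGroup.mk w) (FreeGroup.mk [(edgeWord r a t₁, ε)]) =
        FreeGroup.mk [(a, ε)] * FreeGroup.mk t := by
      cases ε
      · have h1 : t₁ = r ((a, false) :: t) := rfl
        have h2 : r ((a, true) :: t₁) = t := by
          rw [h1, h.cons_rep]
          exact (h.cancel a true t).trans ht
        rw [mk_singleton_false, map_inv, FreeGroup.lift_apply_of, mk_edgeWord, h2, ← h1,
          mk_singleton_false]
        group
      · have h1 : t₁ = t := rfl
        rw [mk_singleton_true, FreeGroup.lift_apply_of, mk_edgeWord, h1, mk_singleton_true]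
        group
    unfold rewriteStep
    simp only [← ht₁]
    split_ifs with htree
    · refine ⟨h.idem _, hE, ?_⟩
      have h1 : FreeGroup.lift (fun w : Word A => FreeGroup.mk w)
          (FreeGroup.mk [(edgeWord r a t₁, ε)]) = 1 := by
        cases ε
        · rw [mk_singleton_false, map_inv, FreeGroup.lift_apply_of, htree.mk_edgeWord_eq_one,
            inv_one]
        · rw [mk_singleton_true, FreeGroup.lift_apply_of, htree.mk_edgeWord_eq_one]
      rw [h1, mul_one] at hmk
      rw [hmk, mul_assoc, hval, ← mk_cons]
    · refine ⟨h.idem _, fun p hp => ?_, ?_⟩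
      · rcases List.mem_cons.1 hp with rfl | hp
        · exact ⟨a, t₁, hrt₁, htree, rfl⟩
        · exact hE p hp
      · rw [mk_cons _ E, map_mul, ← mul_assoc, hmk, mul_assoc, hval, ← mk_cons]

/-- For a word in `K` the process ends at the representative of the trivial coset, the empty word.
-/
theorem IsSchreierRep.rewriteWord_eq (h : IsSchreierRep K r) {w : Word A}
    (hw : FreeGroup.mk w ∈ K) :
    FreeGroup.lift (fun w : Word A => FreeGroup.mk w) (FreeGroup.mk (rewriteWord r w).2) =
      FreeGroup.mk w := by
  obtain ⟨ht, hE, hval⟩ := h.rewriteWord_spec w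
  have hmem : FreeGroup.lift (fun w : Word A => FreeGroup.mk w)
      (FreeGroup.mk (rewriteWord r w).2) ∈ K := by
    rw [FreeGroup.lift_mk]
    refine Subgroup.list_prod_mem _ fun x hx => ?_
    obtain ⟨⟨v, ε⟩, hp, rfl⟩ := List.mem_map.1 hx
    obtain ⟨a, t, -, -, hv⟩ := hE _ hp
    have : FreeGroup.mk v ∈ K := by
      have hv : edgeWord r a t = v := hv
      rw [← hv]
      exact h.mk_edgeWord_mem a t
    cases ε
    exacts [inv_mem this, this]
  have hnil : (rewriteWord r w).1 = [] := h.eq_nil ht (by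
    rw [eq_mul_inv_of_mul_eq hval]
    exact mul_mem hw (inv_mem hmem))
  rwa [hnil, ← FreeGroup.one_eq_mk, one_mul] at hval

/-- A subset of a basis which generates is the whole basis. -/
theorem mem_of_isBasisOf {S : Set (Word A)} {L : List (Word A)}
    (hS : IsBasisOf (fun w : S => FreeGroup.mk (w : Word A)) K) (hL : ∀ w ∈ L, w ∈ S)
    (hgen : gen L = K) {w : Word A} (hw : w ∈ S) : w ∈ L := by
  classical
  obtain ⟨b, hb⟩ := hS
  by_contra hne
  -- This homomorphism kills every basis element except the missing one, so it kills `gen L = K`, a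
  -- contradiction.
  let φ : K →* Multiplicative ℤ := b.lift fun s => if s = ⟨w, hw⟩ then Multiplicative.ofAdd 1 else 1
  have hle : gen L ≤ φ.ker.map K.subtype := (gen_le_iff _ _).2 fun v hv => by
    refine ⟨b ⟨v, hL v hv⟩, ?_, hb _⟩
    have hvw : (⟨v, hL v hv⟩ : S) ≠ ⟨w, hw⟩ := fun h => by
      have h' : v = w := congrArg Subtype.val h
      exact hne (h' ▸ hv)
    simp [φ, hvw]
  rw [hgen] at hle
  obtain ⟨y, hy, hyw⟩ := hle (b ⟨w, hw⟩).2
  have hyw : y = b ⟨w, hw⟩ := Subtype.ext hyw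
  have hy : φ y = 1 := hy
  rw [hyw] at hy
  simp [φ] at hy

theorem isBasisOf_list {S : Set (Word A)} {L : List (Word A)}
    (hS : IsBasisOf (fun w : S => FreeGroup.mk (w : Word A)) K) (hL : ∀ w ∈ L, w ∈ S)
    (hgen : gen L = K) (hnd : L.Nodup) :
    IsBasisOf (fun i : Fin L.length => FreeGroup.mk (L.get i)) K := by
  classical
  have hmem : ∀ w, w ∈ L ↔ w ∈ S := fun w => ⟨hL w, mem_of_isBasisOf hS hL hgen⟩
  obtain ⟨b, hb⟩ := hS
  let e : Fin L.length ≃ S := (hnd.getEquiv L).trans (Equiv.subtypeEquivRight hmem)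
  refine ⟨b.reindex e.symm, fun i => ?_⟩
  rw [FreeGroupBasis.reindex_apply, hb]
  rfl

/-- A finitely generated group is generated by finitely many elements of a given basis. -/
theorem exists_list_gen_eq {S : Set (Word A)}
    (hS : IsBasisOf (fun w : S => FreeGroup.mk (w : Word A)) K) (hK : K.FG) :
    ∃ L : List (Word A), (∀ w ∈ L, w ∈ S) ∧ gen L = K := by
  obtain ⟨b, hb⟩ := hS
  have hone : ∀ g : K, ∃ L : List (Word A), (∀ w ∈ L, w ∈ S) ∧ (g : FreeGroup A) ∈ gen L := by
    intro g
    obtain ⟨y, rfl⟩ := b.repr.symm.surjective g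
    induction y using FreeGroup.induction_on with
    | C1 => exact ⟨[], by simp, by simp⟩
    | of s =>
      refine ⟨[s], by simp, ?_⟩
      have : ((b.repr.symm (FreeGroup.of s) : K) : FreeGroup A) = FreeGroup.mk (s : Word A) := hb s
      rw [this]
      exact mk_mem_gen (by simp)
    | inv_of s ih =>
      obtain ⟨L, hL, h⟩ := ih
      exact ⟨L, hL, by rw [map_inv]; exact inv_mem h⟩
    | mul y y' ih ih' =>
      obtain ⟨L, hL, h⟩ := ih
      obtain ⟨L', hL', h'⟩ := ih'
      refine ⟨L ++ L', fun w hw => (List.mem_append.1 hw).elim (hL w) (hL' w), ?_⟩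
      rw [map_mul]
      exact mul_mem (gen_mono (by simp +contextual) h) (gen_mono (by simp +contextual) h')
  obtain ⟨V, rfl⟩ := exists_gen_eq hK
  have hV : ∀ V' : List (Word A), (∀ v ∈ V', v ∈ V) →
      ∃ L : List (Word A), (∀ w ∈ L, w ∈ S) ∧ gen V' ≤ gen L := by
    intro V' hV'
    induction V' with
    | nil => exact ⟨[], by simp, le_rfl⟩
    | cons v V' ih =>
      obtain ⟨L, hL, h⟩ := ih fun w hw => hV' w (by simp [hw])
      obtain ⟨L', hL', h'⟩ := hone ⟨FreeGroup.mk v, mk_mem_gen (hV' v (by simp))⟩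
      refine ⟨L' ++ L, fun w hw => (List.mem_append.1 hw).elim (hL' w) (hL w), ?_⟩
      refine (gen_le_iff _ _).2 fun w hw => ?_
      rcases List.mem_cons.1 hw with rfl | hw
      · exact gen_mono (by simp +contextual) h'
      · exact gen_mono (by simp +contextual) (h (mk_mem_gen hw))
  obtain ⟨L, hL, h⟩ := hV V fun _ h => h
  refine ⟨L, hL, le_antisymm ((gen_le_iff _ _).2 fun w hw => ?_) h⟩
  rw [← show ((b ⟨w, hL w hw⟩ : gen V) : FreeGroup A) = FreeGroup.mk w from hb _]
  exact (b ⟨w, hL w hw⟩).2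

end Schreier

/-! ### Passing between the alphabet and its numbering -/

section Transfer

theorem codeWord_cons (ν : A → ℕ) (x : A × Bool) (w : Word A) :
    codeWord ν (x :: w) = (ν x.1, x.2) :: codeWord ν w := rfl

theorem codeWord_append (ν : A → ℕ) (v w : Word A) :
    codeWord ν (v ++ w) = codeWord ν v ++ codeWord ν w := List.map_append

theorem codeWord_invRev (ν : A → ℕ) (w : Word A) :
    codeWord ν (FreeGroup.invRev w) = FreeGroup.invRev (codeWord ν w) := by
  simp [codeWord, FreeGroup.invRev, Function.comp_def, Prod.map]

theorem codeWord_injective {ν : A → ℕ} (hν : Function.Injective ν) :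
    Function.Injective (codeWord ν) :=
  List.map_injective_iff.2 (hν.prodMap Function.injective_id)

theorem codeWord_powWord (ν : A → ℕ) (a : A) (m : ℕ) :
    codeWord ν (powWord a m) = powWord (ν a) m := by
  simp [codeWord, powWord]

theorem mem_letters_of_mem {V : List (Word A)} {w : Word A} (hw : w ∈ V) {x : A × Bool}
    (hx : x ∈ w) : x.1 ∈ letters V := ⟨w, hw, x.2, hx⟩

/-- A left inverse of `FreeGroup.map ν` on the words concerned. Numbers that name no relevant letter
go to `1`, so injectivity on the occurring letters suffices; this is what allows infinite alphabets.
-/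
theorem exists_decoding {ν : A → ℕ} {V : List (Word A)} (hν : Set.InjOn ν (letters V)) :
    ∃ μ : FreeGroup ℕ →* FreeGroup A, ∀ w ∈ V, μ (FreeGroup.mk (codeWord ν w)) = FreeGroup.mk w := by
  classical
  let d : ℕ → FreeGroup A := fun k =>
    if h : ∃ a ∈ letters V, ν a = k then FreeGroup.of h.choose else 1
  refine ⟨FreeGroup.lift d, fun w hw => ?_⟩
  have key : ((FreeGroup.lift d).comp (FreeGroup.map ν)) (FreeGroup.mk w) =
      (MonoidHom.id (FreeGroup A)) (FreeGroup.mk w) := by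
    refine hom_mk_congr fun x hx => ?_
    have hmem := mem_letters_of_mem hw hx
    have h : ∃ a ∈ letters V, ν a = ν x.1 := ⟨x.1, hmem, rfl⟩
    rw [MonoidHom.comp_apply, FreeGroup.map.of, FreeGroup.lift_apply_of, MonoidHom.id_apply]
    simp only [d]
    rw [dif_pos h, hν h.choose_spec.1 hmem h.choose_spec.2]
  exact key

theorem map_commutator_le {G G' : Type*} [Group G] [Group G'] (φ : G →* G') :
    commutator G ≤ (commutator G').comap φ := by
  rw [commutator_def, Subgroup.commutator_le]
  intro x _ y _
  rw [Subgroup.mem_comap, map_commutatorElement]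
  exact Subgroup.commutator_mem_commutator trivial trivial

theorem mem_gen_codeWord_iff {ν : A → ℕ} {W : List (Word A)} {u : Word A}
    (hν : Set.InjOn ν (letters (u :: W))) :
    FreeGroup.mk (codeWord ν u) ∈ gen (W.map (codeWord ν)) ↔ FreeGroup.mk u ∈ gen W := by
  obtain ⟨μ, hμ⟩ := exists_decoding hν
  constructor
  · intro h
    have hle : gen (W.map (codeWord ν)) ≤ (gen W).comap μ := (gen_le_iff _ _).2 fun v hv => by
      obtain ⟨w, hw, rfl⟩ := List.mem_map.1 hv
      rw [Subgroup.mem_comap, hμ w (by simp [hw])]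
      exact mk_mem_gen hw
    rw [← hμ u (by simp)]
    exact hle h
  · intro h
    have hle : gen W ≤ (gen (W.map (codeWord ν))).comap (FreeGroup.map ν) :=
      (gen_le_iff _ _).2 fun w hw => mk_mem_gen (List.mem_map_of_mem hw)
    exact hle h

theorem mem_gen_sup_codeWord_iff {ν : A → ℕ} {W : List (Word A)} {u : Word A}
    (hν : Set.InjOn ν (letters (u :: W))) :
    FreeGroup.mk (codeWord ν u) ∈ gen (W.map (codeWord ν)) ⊔ commutator (FreeGroup ℕ) ↔
      FreeGroup.mk u ∈ gen W ⊔ commutator (FreeGroup A) := by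
  obtain ⟨μ, hμ⟩ := exists_decoding hν
  constructor
  · intro h
    have hle : gen (W.map (codeWord ν)) ⊔ commutator (FreeGroup ℕ) ≤
        (gen W ⊔ commutator (FreeGroup A)).comap μ := by
      refine sup_le ((gen_le_iff _ _).2 fun v hv => ?_)
        ((map_commutator_le μ).trans (Subgroup.comap_mono le_sup_right))
      obtain ⟨w, hw, rfl⟩ := List.mem_map.1 hv
      rw [Subgroup.mem_comap, hμ w (by simp [hw])]
      exact le_sup_left (a := gen W) (mk_mem_gen hw)
    rw [← hμ u (by simp)]
    exact hle h
  · intro h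
    have hle : gen W ⊔ commutator (FreeGroup A) ≤ (gen (W.map (codeWord ν)) ⊔
        commutator (FreeGroup ℕ)).comap (FreeGroup.map ν) :=
      sup_le ((gen_le_iff _ _).2 fun w hw =>
        le_sup_left (a := gen (W.map (codeWord ν))) (mk_mem_gen (List.mem_map_of_mem hw)))
        ((map_commutator_le _).trans (Subgroup.comap_mono le_sup_right))
    exact hle h

/-- All letters of the word are less than `n`. -/
def LettersBelow (n : ℕ) (w : Word ℕ) : Prop := ∀ x ∈ w, x.1 < n

/-- `ν` numbers the letters bijectively by `0, …, n - 1`. -/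
structure IsBijectiveNumbering (ν : A → ℕ) (n : ℕ) : Prop where
  inj : Function.Injective ν
  lt : ∀ a, ν a < n
  surj : ∀ k < n, ∃ a, ν a = k

theorem IsNumbering.isBijectiveNumbering [Finite A] {ν : A → ℕ} {S : Set A}
    (h : IsNumbering ν S) : IsBijectiveNumbering ν (Nat.card A) := by
  have hinj := h.injective_of_finite ‹_›
  have hlt := h.lt_card_of_finite ‹_›
  refine ⟨hinj, hlt, fun k hk => ?_⟩
  have hbij : Function.Bijective fun a => (⟨ν a, hlt a⟩ : Fin (Nat.card A)) := by
    rw [Nat.bijective_iff_injective_and_card]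
    exact ⟨fun a b hab => hinj (congrArg Fin.val hab), by simp⟩
  obtain ⟨a, ha⟩ := hbij.2 ⟨k, hk⟩
  exact ⟨a, congrArg Fin.val ha⟩

theorem isBijectiveNumbering_fin (n : ℕ) : IsBijectiveNumbering (Fin.val : Fin n → ℕ) n :=
  ⟨Fin.val_injective, Fin.isLt, fun k hk => ⟨⟨k, hk⟩, rfl⟩⟩

namespace IsBijectiveNumbering

variable {ν : A → ℕ} {n : ℕ}

theorem forall_iff (h : IsBijectiveNumbering ν n) {p : ℕ → Prop} :
    (∀ k < n, p k) ↔ ∀ a, p (ν a) :=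
  ⟨fun hp a => hp _ (h.lt a), fun hp k hk => by obtain ⟨a, rfl⟩ := h.surj k hk; exact hp a⟩

theorem lettersBelow_iff (h : IsBijectiveNumbering ν n) (w : Word ℕ) :
    LettersBelow n w ↔ ∃ v : Word A, codeWord ν v = w := by
  constructor
  · intro hw
    induction w with
    | nil => exact ⟨[], rfl⟩
    | cons x w ih =>
      obtain ⟨v, rfl⟩ := ih fun y hy => hw y (by simp [hy])
      obtain ⟨a, ha⟩ := h.surj x.1 (hw x (by simp))
      exact ⟨(a, x.2) :: v, by rw [codeWord_cons, ha]⟩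
  · rintro ⟨v, rfl⟩ x hx
    obtain ⟨y, -, rfl⟩ := List.mem_map.1 hx
    exact h.lt _

theorem exists_map_codeWord (h : IsBijectiveNumbering ν n) {W : List (Word ℕ)}
    (hW : ∀ w ∈ W, LettersBelow n w) : ∃ V : List (Word A), V.map (codeWord ν) = W := by
  induction W with
  | nil => exact ⟨[], rfl⟩
  | cons w W ih =>
    obtain ⟨V, rfl⟩ := ih fun w hw => hW w (by simp [hw])
    obtain ⟨v, rfl⟩ := (h.lettersBelow_iff w).1 (hW w (by simp))
    exact ⟨v :: V, rfl⟩

end IsBijectiveNumbering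

end Transfer

/-! ### Decidable criteria on named words -/

section Criteria

/-- A finite collection of memberships which decides whether a subgroup of the free group on the
first `n` letters contains the derived subgroup. -/
def ContainsDerived (n : ℕ) (W : List (Word ℕ)) : Prop :=
  (∀ a < n, ∀ b < n, FreeGroup.mk [(a, true), (b, true), (a, false), (b, false)] ∈ gen W) ∧
  ∀ a < n, ∀ w ∈ W, FreeGroup.mk ((a, true) :: (w ++ [(a, false)])) ∈ gen W ∧
    FreeGroup.mk ((a, false) :: (w ++ [(a, true)])) ∈ gen W

theorem IsBijectiveNumbering.containsDerived_iff {ν : A → ℕ} {n : ℕ}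
    (h : IsBijectiveNumbering ν n) (W : List (Word A)) :
    ContainsDerived n (W.map (codeWord ν)) ↔ commutator (FreeGroup A) ≤ gen W := by
  have hmem : ∀ u, FreeGroup.mk (codeWord ν u) ∈ gen (W.map (codeWord ν)) ↔
      FreeGroup.mk u ∈ gen W := fun u => mem_gen_codeWord_iff h.inj.injOn
  rw [commutator_le_gen_iff, ContainsDerived]
  refine and_congr ?_ ?_
  · rw [h.forall_iff]
    refine forall_congr' fun a => ?_
    rw [h.forall_iff]
    exact forall_congr' fun b => hmem [(a, true), (b, true), (a, false), (b, false)]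
  · rw [h.forall_iff]
    refine forall_congr' fun a => ?_
    have h1 : ∀ ε (w : Word A), FreeGroup.mk ((ν a, ε) :: (codeWord ν w ++ [(ν a, !ε)])) ∈
        gen (W.map (codeWord ν)) ↔ FreeGroup.mk ((a, ε) :: (w ++ [(a, !ε)])) ∈ gen W :=
      fun ε w => by
        rw [← hmem, codeWord_cons, codeWord_append]
        rfl
    simp only [List.forall_mem_map, Bool.forall_bool]
    constructor
    · intro hW
      exact ⟨fun w hw => (h1 false w).1 (hW w hw).2, fun w hw => (h1 true w).1 (hW w hw).1⟩
    · rintro ⟨h2, h3⟩ w hw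
      exact ⟨(h1 true w).2 (h3 w hw), (h1 false w).2 (h2 w hw)⟩

/-- The condition for finite generation of the closure of a subgroup of the free group on the first
`n` letters. -/
def ClosureFG (n : ℕ) (W : List (Word ℕ)) : Prop :=
  n < 2 ∨ ∃ m : ℕ, 0 < m ∧ ∀ a < n, FreeGroup.of a ^ m ∈ gen W ⊔ commutator (FreeGroup ℕ)

theorem IsBijectiveNumbering.card_eq {ν : A → ℕ} {n : ℕ} (h : IsBijectiveNumbering ν n) :
    Nat.card A = n := by
  have hbij : Function.Bijective fun a => (⟨ν a, h.lt a⟩ : Fin n) :=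
    ⟨fun a b hab => h.inj (congrArg Fin.val hab), fun k => by
      obtain ⟨a, ha⟩ := h.surj k.1 k.2
      exact ⟨a, Fin.ext ha⟩⟩
  rw [Nat.card_congr (Equiv.ofBijective _ hbij), Nat.card_fin]

theorem IsBijectiveNumbering.finite {ν : A → ℕ} {n : ℕ} (h : IsBijectiveNumbering ν n) :
    Finite A :=
  Finite.of_injective (fun a => (⟨ν a, h.lt a⟩ : Fin n))
    fun _ _ hab => h.inj (congrArg Fin.val hab)

/-- With fewer than two letters the derived subgroup is trivial and the closure is `H` itself. This
covers the exceptional case of the finite index criterion. -/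
theorem IsBijectiveNumbering.closureFG_iff {ν : A → ℕ} {n : ℕ}
    (h : IsBijectiveNumbering ν n) (W : List (Word A)) :
    ClosureFG n (W.map (codeWord ν)) ↔ (gen W ⊔ commutator (FreeGroup A)).FG := by
  have := h.finite
  by_cases hn : n < 2
  · have : Subsingleton A := ⟨fun a b => h.inj (by have := h.lt a; have := h.lt b; omega)⟩
    rw [commutator_eq_bot_of_subsingleton, sup_bot_eq]
    exact ⟨fun _ => gen_fg W, fun _ => Or.inl hn⟩
  · rw [fg_iff_forall_pow_mem (fun hc => hn (by rw [← h.card_eq, hc.1]; norm_num)), ClosureFG,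
      or_iff_right hn, forall_pow_mem_iff, h.forall_iff]
    refine forall_congr' fun a => exists_congr fun m => and_congr_right fun _ => ?_
    rw [← mk_powWord, ← mk_powWord, ← codeWord_powWord]
    exact mem_gen_sup_codeWord_iff h.inj.injOn

variable {α : Type*} [Primcodable α] {n : α → ℕ} {W : α → List (Word ℕ)}

theorem computablePred_lettersBelow {w : α → Word ℕ} (hn : Computable n) (hw : Computable w) :
    ComputablePred fun a => LettersBelow (n a) (w a) :=
  ComputablePred.forall_mem_list (p := fun a (x : ℕ × Bool) => x.1 < n a)
    (ComputablePred.lt (Computable.fst.comp Computable.snd) (hn.comp Computable.fst)) hw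

theorem computablePred_containsDerived (hn : Computable n) (hW : Computable W) :
    ComputablePred fun a => ContainsDerived (n a) (W a) := by
  have hlet : ∀ {β : Type _} [Primcodable β] {f : β → ℕ} (ε : Bool), Computable f →
      Computable fun b => (f b, ε) := fun ε hf => hf.pair (Computable.const ε)
  refine ComputablePred.and ?_ ?_
  · refine ComputablePred.forall_lt (p := fun a i => ∀ j < n a,
      FreeGroup.mk [(i, true), (j, true), (i, false), (j, false)] ∈ gen (W a)) ?_ hn
    refine ComputablePred.forall_lt (p := fun (q : α × ℕ) j =>
      FreeGroup.mk [(q.2, true), (j, true), (q.2, false), (j, false)] ∈ gen (W q.1)) ?_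
      (hn.comp Computable.fst)
    refine computablePred_mem_gen (hW.comp (Computable.fst.comp Computable.fst)) ?_
    have hi : Computable fun q : (α × ℕ) × ℕ => q.1.2 := Computable.snd.comp Computable.fst
    have hj : Computable fun q : (α × ℕ) × ℕ => q.2 := Computable.snd
    exact Computable.list_cons.comp (hlet true hi) (Computable.list_cons.comp (hlet true hj)
      (Computable.list_cons.comp (hlet false hi) (Computable.list_cons.comp (hlet false hj)
        (Computable.const []))))
  · refine ComputablePred.forall_lt (p := fun a i => ∀ w ∈ W a,
      FreeGroup.mk ((i, true) :: (w ++ [(i, false)])) ∈ gen (W a) ∧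
        FreeGroup.mk ((i, false) :: (w ++ [(i, true)])) ∈ gen (W a)) ?_ hn
    refine ComputablePred.forall_mem_list (p := fun (q : α × ℕ) w =>
      FreeGroup.mk ((q.2, true) :: (w ++ [(q.2, false)])) ∈ gen (W q.1) ∧
        FreeGroup.mk ((q.2, false) :: (w ++ [(q.2, true)])) ∈ gen (W q.1)) ?_
      (hW.comp Computable.fst)
    have hi : Computable fun q : (α × ℕ) × Word ℕ => q.1.2 := Computable.snd.comp Computable.fst
    have hW' : Computable fun q : (α × ℕ) × Word ℕ => W q.1.1 :=
      hW.comp (Computable.fst.comp Computable.fst)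
    have hc : ∀ ε : Bool, Computable fun q : (α × ℕ) × Word ℕ =>
        (q.1.2, ε) :: (q.2 ++ [(q.1.2, !ε)]) := fun ε =>
      Computable.list_cons.comp (hlet ε hi) (Computable.list_append.comp Computable.snd
        (Computable.list_cons.comp (hlet (!ε) hi) (Computable.const [])))
    exact (computablePred_mem_gen hW' (hc true)).and (computablePred_mem_gen hW' (hc false))

theorem computablePred_closureFG (hn : Computable n) (hW : Computable W) :
    ComputablePred fun a => ClosureFG (n a) (W a) :=
  (ComputablePred.lt hn (Computable.const 2)).or (computablePred_forall_pow_mem hn hW)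

end Criteria

/-! ### A computable Schreier transversal and its basis -/

section Representatives

open Encodable

/-- `w` may serve as a representative of the coset of `v` modulo the closure of `gen W`. -/
def IsCosetRep (n : ℕ) (W : List (Word ℕ)) (v w : Word ℕ) : Prop :=
  (LettersBelow n v → LettersBelow n w) ∧
    FreeGroup.mk (FreeGroup.invRev w ++ v) ∈ gen W ⊔ commutator (FreeGroup ℕ)

/-- The letter bound in `IsCosetRep` is an implication, so every word may represent itself and the
search is total on all inputs. -/
theorem exists_minimalRep : ∃ f : (ℕ × List (Word ℕ)) × Word ℕ → Word ℕ, Computable f ∧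
    ∀ p, IsCosetRep p.1.1 p.1.2 p.2 (f p) ∧
      ∀ w, IsCosetRep p.1.1 p.1.2 p.2 w → encode (f p) ≤ encode w := by
  refine ComputablePred.exists_computable_choice
    (R := fun (p : (ℕ × List (Word ℕ)) × Word ℕ) w => IsCosetRep p.1.1 p.1.2 p.2 w) ?_ fun p =>
      ⟨p.2, id, ?_⟩
  · have hn : Computable fun q : ((ℕ × List (Word ℕ)) × Word ℕ) × Word ℕ => q.1.1.1 :=
      Computable.fst.comp (Computable.fst.comp Computable.fst)
    have hW : Computable fun q : ((ℕ × List (Word ℕ)) × Word ℕ) × Word ℕ => q.1.1.2 :=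
      Computable.snd.comp (Computable.fst.comp Computable.fst)
    have hv : Computable fun q : ((ℕ × List (Word ℕ)) × Word ℕ) × Word ℕ => q.1.2 :=
      Computable.snd.comp Computable.fst
    exact ((computablePred_lettersBelow hn hv).imp
      (computablePred_lettersBelow hn Computable.snd)).and
      (computablePred_mem_gen_sup_commutator hW
        (Computable.list_append.comp (primrec_invRev.to_comp.comp Computable.snd) hv))
  · rw [← FreeGroup.mul_mk, ← FreeGroup.inv_mk, inv_mul_cancel]
    exact one_mem _

/-- The representative with the least code of a coset modulo the closure of `gen W`. -/
noncomputable def minimalRep (n : ℕ) (W : List (Word ℕ)) (w : Word ℕ) : Word ℕ :=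
  exists_minimalRep.choose ((n, W), w)

theorem computable_minimalRep {α : Type*} [Primcodable α] {n : α → ℕ} {W : α → List (Word ℕ)}
    {w : α → Word ℕ} (hn : Computable n) (hW : Computable W) (hw : Computable w) :
    Computable fun a => minimalRep (n a) (W a) (w a) :=
  exists_minimalRep.choose_spec.1.comp ((hn.pair hW).pair hw)

theorem minimalRep_spec (n : ℕ) (W : List (Word ℕ)) (w : Word ℕ) :
    IsCosetRep n W w (minimalRep n W w) :=
  (exists_minimalRep.choose_spec.2 ((n, W), w)).1

theorem encode_minimalRep_le {n : ℕ} {W : List (Word ℕ)} {v w : Word ℕ}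
    (h : IsCosetRep n W v w) : encode (minimalRep n W v) ≤ encode w :=
  (exists_minimalRep.choose_spec.2 ((n, W), v)).2 w h

/-- The code of `x :: t` is strictly increasing in the code of `t`, so a tail that were not minimal
in its coset could be replaced to give a smaller representative. The empty word has code `0`, hence
represents its coset. -/
theorem isSchreierRep_of_codeWord {ν : A → ℕ} {n : ℕ} (h : IsBijectiveNumbering ν n)
    {W : List (Word A)} {r : Word A → Word A}
    (hr : ∀ w, codeWord ν (r w) = minimalRep n (W.map (codeWord ν)) (codeWord ν w)) :
    IsSchreierRep (gen W ⊔ commutator (FreeGroup A)) r := by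
  have hbelow : ∀ w : Word A, LettersBelow n (codeWord ν w) := fun w =>
    (h.lettersBelow_iff _).2 ⟨w, rfl⟩
  have hiff : ∀ v w : Word A, IsCosetRep n (W.map (codeWord ν)) (codeWord ν v) (codeWord ν w) ↔
      (FreeGroup.mk w)⁻¹ * FreeGroup.mk v ∈ gen W ⊔ commutator (FreeGroup A) := fun v w => by
    rw [IsCosetRep, ← codeWord_invRev, ← codeWord_append,
      mem_gen_sup_codeWord_iff h.inj.injOn, ← FreeGroup.mul_mk, ← FreeGroup.inv_mk]
    exact and_iff_right fun _ => hbelow w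
  have hmem : ∀ w, (FreeGroup.mk (r w))⁻¹ * FreeGroup.mk w ∈
      gen W ⊔ commutator (FreeGroup A) := fun w => by
    rw [← hiff, hr]
    exact minimalRep_spec _ _ _
  have hle : ∀ v w, (FreeGroup.mk w)⁻¹ * FreeGroup.mk v ∈ gen W ⊔ commutator (FreeGroup A) →
      encode (codeWord ν (r v)) ≤ encode (codeWord ν w) := fun v w hvw => by
    rw [hr]
    exact encode_minimalRep_le ((hiff v w).2 hvw)
  have hinj : ∀ v w : Word A, encode (codeWord ν v) = encode (codeWord ν w) → v = w :=
    fun v w hvw => codeWord_injective h.inj (encode_injective hvw)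
  refine ⟨hmem, fun w w' hww' => hinj _ _ (le_antisymm (hle _ _ ?_) (hle _ _ ?_)), ?_, ?_⟩
  · have h1 := mul_mem (hmem w') (inv_mem hww')
    rw [mul_inv_rev, inv_inv, mul_assoc, mul_inv_cancel_left] at h1
    exact h1
  · have h1 := mul_mem (hmem w) hww'
    rwa [mul_assoc, mul_inv_cancel_left] at h1
  · refine hinj _ _ (le_antisymm (hle _ _ (by
      rw [inv_mul_cancel]
      exact one_mem _)) ?_)
    exact Nat.zero_le _
  · intro x t hxt
    by_contra hne
    have h1 : encode (codeWord ν (r t)) < encode (codeWord ν t) :=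
      lt_of_le_of_ne (hle t t (by rw [inv_mul_cancel]; exact one_mem _))
        fun he => hne (hinj _ _ he)
    have h2 := hle (x :: t) (x :: r t) (by
      rw [mk_cons x (r t), mk_cons x t, mul_inv_rev, mul_assoc, inv_mul_cancel_left]
      exact hmem t)
    rw [hxt, codeWord_cons, codeWord_cons, encode_list_cons, encode_list_cons,
      Nat.succ_le_succ_iff] at h2
    exact absurd h2 (not_le.2 (Nat.pair_lt_pair_right _ h1))

theorem exists_isSchreierRep {ν : A → ℕ} {n : ℕ} (h : IsBijectiveNumbering ν n)
    (W : List (Word A)) : ∃ r : Word A → Word A,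
      (∀ w, codeWord ν (r w) = minimalRep n (W.map (codeWord ν)) (codeWord ν w)) ∧
        IsSchreierRep (gen W ⊔ commutator (FreeGroup A)) r := by
  have hex : ∀ w : Word A, ∃ v : Word A,
      codeWord ν v = minimalRep n (W.map (codeWord ν)) (codeWord ν w) := fun w =>
    (h.lettersBelow_iff _).1
      ((minimalRep_spec _ _ _).1 ((h.lettersBelow_iff _).2 ⟨w, rfl⟩))
  choose r hr using hex
  exact ⟨r, hr, isSchreierRep_of_codeWord h hr⟩

section Code

variable {ν : A → ℕ} {r : Word A → Word A} {r' : Word ℕ → Word ℕ}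

theorem codeWord_edgeWord (hr : ∀ w, codeWord ν (r w) = r' (codeWord ν w)) (a : A) (t : Word A) :
    codeWord ν (edgeWord r a t) = edgeWord r' (ν a) (codeWord ν t) := by
  rw [edgeWord, codeWord_append, codeWord_invRev, hr]
  rfl

theorem rep_codeWord_iff (hν : Function.Injective ν)
    (hr : ∀ w, codeWord ν (r w) = r' (codeWord ν w)) (t : Word A) :
    r' (codeWord ν t) = codeWord ν t ↔ r t = t := by
  rw [← hr]
  exact (codeWord_injective hν).eq_iff

theorem isTreeEdge_codeWord_iff (hν : Function.Injective ν)
    (hr : ∀ w, codeWord ν (r w) = r' (codeWord ν w)) (a : A) (t : Word A) :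
    IsTreeEdge r' (ν a) (codeWord ν t) ↔ IsTreeEdge r a t := by
  have h1 : r' ((ν a, true) :: codeWord ν t) = codeWord ν (r ((a, true) :: t)) :=
    (hr ((a, true) :: t)).symm
  rw [IsTreeEdge, IsTreeEdge, h1]
  exact or_congr
    ((codeWord_injective hν).eq_iff (a := r ((a, true) :: t)) (b := (a, true) :: t))
    ((codeWord_injective hν).eq_iff (a := t) (b := (a, false) :: r ((a, true) :: t)))

theorem rewriteWord_codeWord (hν : Function.Injective ν)
    (hr : ∀ w, codeWord ν (r w) = r' (codeWord ν w)) (w : Word A) :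
    rewriteWord r' (codeWord ν w) = (codeWord ν (rewriteWord r w).1,
      (rewriteWord r w).2.map (Prod.map (codeWord ν) id)) := by
  induction w with
  | nil => rfl
  | cons x w ih =>
    have h1 : rewriteWord r (x :: w) = rewriteStep r x (rewriteWord r w) := rfl
    have h2 : rewriteWord r' (codeWord ν (x :: w)) =
        rewriteStep r' (ν x.1, x.2) (rewriteWord r' (codeWord ν w)) := rfl
    rw [h1, h2, ih]
    generalize rewriteWord r w = s
    obtain ⟨a, ε⟩ := x
    have h3 : r' ((ν a, ε) :: codeWord ν s.1) = codeWord ν (r ((a, ε) :: s.1)) :=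
      (hr ((a, ε) :: s.1)).symm
    have h4 : (if ε = true then codeWord ν s.1 else r' ((ν a, ε) :: codeWord ν s.1)) =
        codeWord ν (if ε = true then s.1 else r ((a, ε) :: s.1)) := by
      rw [h3]
      split_ifs <;> rfl
    simp only [rewriteStep]
    rw [h4, h3, ← codeWord_edgeWord hr]
    have h5 := isTreeEdge_codeWord_iff hν hr a (if ε = true then s.1 else r ((a, ε) :: s.1))
    by_cases htree : IsTreeEdge r a (if ε = true then s.1 else r ((a, ε) :: s.1))
    · rw [if_pos htree, if_pos (h5.2 htree)]
    · rw [if_neg htree, if_neg (fun h => htree (h5.1 h))]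
      rfl

end Code

/-- The pair of a letter and a representative is an edge outside the tree. -/
def IsBasisEdge (n : ℕ) (W : List (Word ℕ)) (p : ℕ × Word ℕ) : Prop :=
  p.1 < n ∧ LettersBelow n p.2 ∧ minimalRep n W p.2 = p.2 ∧
    ¬ IsTreeEdge (minimalRep n W) p.1 p.2

/-- The basis of the closure of `gen W`, as a set of words. -/
def basisWords (n : ℕ) (W : List (Word ℕ)) : Set (Word ℕ) :=
  {w | ∃ p, IsBasisEdge n W p ∧ edgeWord (minimalRep n W) p.1 p.2 = w}

theorem isBasisEdge_iff {ν : A → ℕ} {n : ℕ} (h : IsBijectiveNumbering ν n)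
    {W : List (Word A)} {r : Word A → Word A}
    (hr : ∀ w, codeWord ν (r w) = minimalRep n (W.map (codeWord ν)) (codeWord ν w))
    (p : ℕ × Word ℕ) : IsBasisEdge n (W.map (codeWord ν)) p ↔
      ∃ e : SchreierEdge r, (ν e.1.1, codeWord ν e.1.2) = p := by
  constructor
  · rintro ⟨h1, h2, h3, h4⟩
    obtain ⟨k, w⟩ := p
    obtain ⟨a, rfl⟩ := h.surj k h1
    obtain ⟨t, rfl⟩ := (h.lettersBelow_iff w).1 h2
    exact ⟨⟨(a, t), (rep_codeWord_iff h.inj hr t).1 h3,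
      fun ht => h4 ((isTreeEdge_codeWord_iff h.inj hr a t).2 ht)⟩, rfl⟩
  · rintro ⟨⟨⟨a, t⟩, h1, h2⟩, rfl⟩
    exact ⟨h.lt a, (h.lettersBelow_iff _).2 ⟨t, rfl⟩, (rep_codeWord_iff h.inj hr t).2 h1,
      fun ht => h2 ((isTreeEdge_codeWord_iff h.inj hr a t).1 ht)⟩

theorem basisWords_eq_image {ν : A → ℕ} {n : ℕ} (h : IsBijectiveNumbering ν n)
    {W : List (Word A)} {r : Word A → Word A}
    (hr : ∀ w, codeWord ν (r w) = minimalRep n (W.map (codeWord ν)) (codeWord ν w)) :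
    basisWords n (W.map (codeWord ν)) = codeWord ν '' schreierWords r := by
  ext w
  constructor
  · rintro ⟨p, hp, rfl⟩
    obtain ⟨e, rfl⟩ := (isBasisEdge_iff h hr p).1 hp
    exact ⟨_, ⟨e.1.1, e.1.2, e.2.1, e.2.2, rfl⟩, codeWord_edgeWord hr _ _⟩
  · rintro ⟨_, ⟨a, t, h1, h2, rfl⟩, rfl⟩
    exact ⟨_, (isBasisEdge_iff h hr _).2 ⟨⟨(a, t), h1, h2⟩, rfl⟩,
      (codeWord_edgeWord hr _ _).symm⟩

open Classical in
/-- The words in the basis which come from the edges with code less than `N`. -/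
noncomputable def basisList (n : ℕ) (W : List (Word ℕ)) (N : ℕ) : List (Word ℕ) :=
  (List.range N).flatMap fun i => Option.casesOn (decode₂ (ℕ × Word ℕ) i) [] fun p =>
    if IsBasisEdge n W p then [edgeWord (minimalRep n W) p.1 p.2] else []

theorem mem_basisList_aux {n : ℕ} {W : List (Word ℕ)} {i : ℕ} {w : Word ℕ} [DecidablePred
    (IsBasisEdge n W)] :
    (w ∈ (Option.casesOn (decode₂ (ℕ × Word ℕ) i) [] fun p =>
      if IsBasisEdge n W p then [edgeWord (minimalRep n W) p.1 p.2] else [] : List (Word ℕ))) ↔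
      ∃ p, encode p = i ∧ IsBasisEdge n W p ∧ edgeWord (minimalRep n W) p.1 p.2 = w := by
  rcases hd : decode₂ (ℕ × Word ℕ) i with _ | p
  · simp only [List.not_mem_nil, false_iff, not_exists, not_and]
    rintro p hp
    have : p ∈ decode₂ (ℕ × Word ℕ) i := mem_decode₂.2 hp
    simp [hd] at this
  · have hp : encode p = i := mem_decode₂.1 hd
    have huniq : ∀ q : ℕ × Word ℕ, encode q = i → q = p := fun q hq =>
      encode_injective (hq.trans hp.symm)
    simp only [List.mem_ite_nil_right, List.mem_singleton]
    constructor
    · rintro ⟨h1, rfl⟩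
      exact ⟨p, hp, h1, rfl⟩
    · rintro ⟨q, hq, h1, rfl⟩
      obtain rfl := huniq q hq
      exact ⟨h1, rfl⟩

theorem mem_basisList {n : ℕ} {W : List (Word ℕ)} {N : ℕ} {w : Word ℕ} :
    w ∈ basisList n W N ↔
      ∃ p, encode p < N ∧ IsBasisEdge n W p ∧ edgeWord (minimalRep n W) p.1 p.2 = w := by
  classical
  rw [basisList, List.mem_flatMap]
  constructor
  · rintro ⟨i, hi, hw⟩
    obtain ⟨p, hp, h1, h2⟩ := mem_basisList_aux.1 hw
    exact ⟨p, hp ▸ List.mem_range.1 hi, h1, h2⟩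
  · rintro ⟨p, hp, h1, h2⟩
    exact ⟨encode p, List.mem_range.2 hp, mem_basisList_aux.2 ⟨p, rfl, h1, h2⟩⟩

/-- By `decode₂` each edge appears only at its own code, and distinct edges give distinct words. -/
theorem nodup_basisList {n : ℕ} {W : List (Word ℕ)}
    (hinj : ∀ p q, IsBasisEdge n W p → IsBasisEdge n W q →
      edgeWord (minimalRep n W) p.1 p.2 = edgeWord (minimalRep n W) q.1 q.2 → p = q) (N : ℕ) :
    (basisList n W N).Nodup := by
  classical
  rw [basisList, List.nodup_flatMap]
  constructor
  · intro i _
    rcases decode₂ (ℕ × Word ℕ) i with _ | p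
    · simp
    · simp only
      split_ifs <;> simp
  · refine List.Nodup.pairwise_of_forall_ne List.nodup_range fun i _ j _ hij => ?_
    refine List.disjoint_left.2 fun w hw hw' => hij ?_
    obtain ⟨p, rfl, h1, h2⟩ := mem_basisList_aux.1 hw
    obtain ⟨q, rfl, h3, h4⟩ := mem_basisList_aux.1 hw'
    rw [hinj p q h1 h3 (h2.trans h4.symm)]

section Computable

variable {α : Type*} [Primcodable α] {n : α → ℕ} {W : α → List (Word ℕ)}

theorem computable_edgeWord {a : α → ℕ} {t : α → Word ℕ} (hn : Computable n) (hW : Computable W)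
    (ha : Computable a) (ht : Computable t) :
    Computable fun i => edgeWord (minimalRep (n i) (W i)) (a i) (t i) := by
  have hc : Computable fun i => (a i, true) :: t i :=
    Computable.list_cons.comp (ha.pair (Computable.const true)) ht
  exact Computable.list_append.comp
    (primrec_invRev.to_comp.comp (computable_minimalRep hn hW hc)) hc

theorem computablePred_isTreeEdge {a : α → ℕ} {t : α → Word ℕ} (hn : Computable n)
    (hW : Computable W) (ha : Computable a) (ht : Computable t) :
    ComputablePred fun i => IsTreeEdge (minimalRep (n i) (W i)) (a i) (t i) := by
  have hc : Computable fun i => (a i, true) :: t i :=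
    Computable.list_cons.comp (ha.pair (Computable.const true)) ht
  have hr := computable_minimalRep hn hW hc
  exact (ComputablePred.eq hr hc).or (ComputablePred.eq ht
    (Computable.list_cons.comp (ha.pair (Computable.const false)) hr))

theorem computablePred_isBasisEdge {p : α → ℕ × Word ℕ} (hn : Computable n) (hW : Computable W)
    (hp : Computable p) : ComputablePred fun i => IsBasisEdge (n i) (W i) (p i) := by
  have h1 := Computable.fst.comp hp
  have h2 := Computable.snd.comp hp
  exact (ComputablePred.lt h1 hn).and ((computablePred_lettersBelow hn h2).and
    ((ComputablePred.eq (computable_minimalRep hn hW h2) h2).and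
      (computablePred_isTreeEdge hn hW h1 h2).not))

theorem rePred_basisWords {w : α → Word ℕ} (hn : Computable n) (hW : Computable W)
    (hw : Computable w) : REPred fun i => w i ∈ basisWords (n i) (W i) := by
  refine ComputablePred.exists_re (R := fun i (p : ℕ × Word ℕ) => IsBasisEdge (n i) (W i) p ∧
    edgeWord (minimalRep (n i) (W i)) p.1 p.2 = w i) ?_
  have hn' := hn.comp (Computable.fst (α := α) (β := ℕ × Word ℕ))
  have hW' := hW.comp (Computable.fst (α := α) (β := ℕ × Word ℕ))
  exact (computablePred_isBasisEdge hn' hW' Computable.snd).and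
    (ComputablePred.eq (computable_edgeWord hn' hW' (Computable.fst.comp Computable.snd)
      (Computable.snd.comp Computable.snd)) (hw.comp Computable.fst))

theorem computable_rewriteWord {w : α → Word ℕ} (hn : Computable n) (hW : Computable W)
    (hw : Computable w) : Computable fun i => rewriteWord (minimalRep (n i) (W i)) (w i) := by
  classical
  refine Computable.list_foldr (h := fun i (q : (ℕ × Bool) × Word ℕ × List (Word ℕ × Bool)) =>
    rewriteStep (minimalRep (n i) (W i)) q.1 q.2) hw (Computable.const ([], [])) ?_
  let β := α × (ℕ × Bool) × Word ℕ × List (Word ℕ × Bool)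
  have hn' : Computable fun q : β => n q.1 := hn.comp Computable.fst
  have hW' : Computable fun q : β => W q.1 := hW.comp Computable.fst
  have hx : Computable fun q : β => q.2.1 := Computable.fst.comp Computable.snd
  have hs : Computable fun q : β => q.2.2.1 :=
    Computable.fst.comp (Computable.snd.comp Computable.snd)
  have hE : Computable fun q : β => q.2.2.2 :=
    Computable.snd.comp (Computable.snd.comp Computable.snd)
  have hr : Computable fun q : β => minimalRep (n q.1) (W q.1) (q.2.1 :: q.2.2.1) :=
    computable_minimalRep hn' hW' (Computable.list_cons.comp hx hs)
  have ht : Computable fun q : β => if q.2.1.2 = true then q.2.2.1 else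
      minimalRep (n q.1) (W q.1) (q.2.1 :: q.2.2.1) :=
    Computable.ite (ComputablePred.eq (Computable.snd.comp hx) (Computable.const true)) hs hr
  exact Computable.ite (p := fun q : β => IsTreeEdge (minimalRep (n q.1) (W q.1)) q.2.1.1
      (if q.2.1.2 = true then q.2.2.1 else minimalRep (n q.1) (W q.1) (q.2.1 :: q.2.2.1)))
    (computablePred_isTreeEdge hn' hW' (Computable.fst.comp hx) ht) (hr.pair hE)
    (hr.pair (Computable.list_cons.comp ((computable_edgeWord hn' hW' (Computable.fst.comp hx)
      ht).pair (Computable.snd.comp hx)) hE))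

theorem computable_basisList {N : α → ℕ} (hn : Computable n) (hW : Computable W)
    (hN : Computable N) : Computable fun i => basisList (n i) (W i) (N i) := by
  classical
  refine Computable.list_flatMap (Primrec.list_range.to_comp.comp hN) ?_
  refine Computable.option_casesOn (o := fun q : α × ℕ => decode₂ (ℕ × Word ℕ) q.2)
    (f := fun _ => []) (g := fun q p => if IsBasisEdge (n q.1) (W q.1) p then
      [edgeWord (minimalRep (n q.1) (W q.1)) p.1 p.2] else [])
    (Primrec.decode₂.to_comp.comp Computable.snd) (Computable.const []) ?_
  let β := (α × ℕ) × ℕ × Word ℕ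
  have hn' : Computable fun q : β => n q.1.1 := hn.comp (Computable.fst.comp Computable.fst)
  have hW' : Computable fun q : β => W q.1.1 := hW.comp (Computable.fst.comp Computable.fst)
  exact Computable.ite (p := fun q : β => IsBasisEdge (n q.1.1) (W q.1.1) q.2)
    (computablePred_isBasisEdge hn' hW' Computable.snd)
    (Computable.list_cons.comp (computable_edgeWord hn' hW' (Computable.fst.comp Computable.snd)
      (Computable.snd.comp Computable.snd)) (Computable.const [])) (Computable.const [])

end Computable

/-- The list `L` generates the closure of `gen W`. -/
def GeneratesClosure (n : ℕ) (W L : List (Word ℕ)) : Prop :=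
  (∀ w ∈ W, FreeGroup.mk w ∈ gen L) ∧ ContainsDerived n L

/-- Only this inclusion has to be tested: the words in `basisList` lie in the closure anyway. -/
theorem IsBijectiveNumbering.generatesClosure_iff {ν : A → ℕ} {n : ℕ}
    (h : IsBijectiveNumbering ν n) (W L : List (Word A)) :
    GeneratesClosure n (W.map (codeWord ν)) (L.map (codeWord ν)) ↔
      gen W ⊔ commutator (FreeGroup A) ≤ gen L := by
  rw [GeneratesClosure, h.containsDerived_iff, sup_le_iff, gen_le_iff]
  refine and_congr_left fun _ => ?_
  rw [List.forall_mem_map]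
  exact forall₂_congr fun w _ => mem_gen_codeWord_iff h.inj.injOn

theorem exists_basisList_eq {ν : A → ℕ} {n : ℕ} (h : IsBijectiveNumbering ν n)
    {W : List (Word A)} {r : Word A → Word A}
    (hr : ∀ w, codeWord ν (r w) = minimalRep n (W.map (codeWord ν)) (codeWord ν w)) (N : ℕ) :
    ∃ L : List (Word A), basisList n (W.map (codeWord ν)) N = L.map (codeWord ν) ∧
      L.Nodup ∧ (∀ w ∈ L, w ∈ schreierWords r) := by
  have hS := isSchreierRep_of_codeWord h hr
  have hsub : ∀ w ∈ basisList n (W.map (codeWord ν)) N, w ∈ codeWord ν '' schreierWords r := by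
    intro w hw
    obtain ⟨p, -, hp, rfl⟩ := mem_basisList.1 hw
    rw [← basisWords_eq_image h hr]
    exact ⟨p, hp, rfl⟩
  have hnd : (basisList n (W.map (codeWord ν)) N).Nodup := by
    refine nodup_basisList (fun p q hp hq hpq => ?_) N
    obtain ⟨e, rfl⟩ := (isBasisEdge_iff h hr p).1 hp
    obtain ⟨e', rfl⟩ := (isBasisEdge_iff h hr q).1 hq
    simp only at hpq
    rw [← codeWord_edgeWord hr, ← codeWord_edgeWord hr] at hpq
    rw [hS.edgeWord_injective (codeWord_injective h.inj hpq)]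
  obtain ⟨L, hL⟩ := h.exists_map_codeWord (W := basisList n (W.map (codeWord ν)) N)
    fun w hw => (h.lettersBelow_iff w).2 (by obtain ⟨v, -, hv⟩ := hsub w hw; exact ⟨v, hv⟩)
  refine ⟨L, hL.symm, List.Nodup.of_map (codeWord ν) (hL ▸ hnd), fun w hw => ?_⟩
  obtain ⟨v, hv, hvw⟩ := hsub (codeWord ν w) (hL ▸ List.mem_map_of_mem hw)
  rwa [← codeWord_injective h.inj hvw]

/-- Finitely many generators of the closure involve finitely many basis elements, all of which are
listed up to some bound. -/
theorem exists_generatesClosure {ν : A → ℕ} {n : ℕ} (h : IsBijectiveNumbering ν n)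
    {W : List (Word A)} (hfg : (gen W ⊔ commutator (FreeGroup A)).FG) :
    ∃ N, GeneratesClosure n (W.map (codeWord ν)) (basisList n (W.map (codeWord ν)) N) := by
  obtain ⟨r, hr, hS⟩ := exists_isSchreierRep h W
  obtain ⟨L, hL, hgen⟩ := exists_list_gen_eq hS.isBasisOf hfg
  have hN : ∃ N, ∀ w ∈ L, codeWord ν w ∈ basisList n (W.map (codeWord ν)) N := by
    clear hgen
    induction L with
    | nil => exact ⟨0, by simp⟩
    | cons v L ih =>
      obtain ⟨N, hN⟩ := ih fun w hw => hL w (by simp [hw])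
      have hv : codeWord ν v ∈ basisWords n (W.map (codeWord ν)) := by
        rw [basisWords_eq_image h hr]
        exact ⟨v, hL v (by simp), rfl⟩
      obtain ⟨p, hp, hpv⟩ := hv
      refine ⟨max N (encode p + 1), fun w hw => ?_⟩
      rcases List.mem_cons.1 hw with rfl | hw
      · exact mem_basisList.2 ⟨p, by omega, hp, hpv⟩
      · obtain ⟨q, h1, h2⟩ := mem_basisList.1 (hN w hw)
        exact mem_basisList.2 ⟨q, by omega, h2⟩
  obtain ⟨N, hN⟩ := hN
  obtain ⟨L', hL', -, -⟩ := exists_basisList_eq h hr N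
  refine ⟨N, ?_⟩
  rw [hL'] at hN ⊢
  rw [h.generatesClosure_iff, ← hgen]
  refine gen_mono fun w hw => ?_
  obtain ⟨v, hv, hvw⟩ := List.mem_map.1 (hN w hw)
  rwa [← codeWord_injective h.inj hvw]

/-- The assumptions on the input are decidable, so they can be part of the tested relation; inputs
violating them satisfy it vacuously and the search always terminates. -/
theorem exists_basis_bound : ∃ f : ℕ × List (Word ℕ) → ℕ, Computable f ∧
    ∀ p, (∀ w ∈ p.2, LettersBelow p.1 w) → ClosureFG p.1 p.2 →
      GeneratesClosure p.1 p.2 (basisList p.1 p.2 (f p)) := by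
  let R := fun (p : ℕ × List (Word ℕ)) (N : ℕ) => (∀ w ∈ p.2, LettersBelow p.1 w) →
    ClosureFG p.1 p.2 → GeneratesClosure p.1 p.2 (basisList p.1 p.2 N)
  have hR : ComputablePred fun q : (ℕ × List (Word ℕ)) × ℕ => R q.1 q.2 := by
    have hn : Computable fun q : (ℕ × List (Word ℕ)) × ℕ => q.1.1 :=
      Computable.fst.comp Computable.fst
    have hW : Computable fun q : (ℕ × List (Word ℕ)) × ℕ => q.1.2 :=
      Computable.snd.comp Computable.fst
    have hL := computable_basisList hn hW Computable.snd
    refine ComputablePred.imp ?_ ((computablePred_closureFG hn hW).imp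
      (ComputablePred.and ?_ (computablePred_containsDerived hn hL)))
    · exact ComputablePred.forall_mem_list
        (p := fun (q : (ℕ × List (Word ℕ)) × ℕ) w => LettersBelow q.1.1 w)
        (computablePred_lettersBelow (hn.comp Computable.fst) Computable.snd) hW
    · exact ComputablePred.forall_mem_list
        (p := fun (q : (ℕ × List (Word ℕ)) × ℕ) w =>
          FreeGroup.mk w ∈ gen (basisList q.1.1 q.1.2 q.2))
        (computablePred_mem_gen (hL.comp Computable.fst) Computable.snd) hW
  have hex : ∀ p, ∃ N, R p N := by
    rintro ⟨n, W⟩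
    -- Termination concerns only the named words, so it may be proved over the alphabet `Fin n`.
    have h := isBijectiveNumbering_fin n
    by_cases hW : ∀ w ∈ W, LettersBelow n w
    · obtain ⟨V, rfl⟩ := h.exists_map_codeWord hW
      by_cases hfg : ClosureFG n (V.map (codeWord Fin.val))
      · obtain ⟨N, hN⟩ := exists_generatesClosure h ((h.closureFG_iff V).1 hfg)
        exact ⟨N, fun _ _ => hN⟩
      · exact ⟨0, fun _ h => absurd h hfg⟩
    · exact ⟨0, fun h => absurd h hW⟩
  obtain ⟨f, hf, hspec⟩ := ComputablePred.exists_computable_choice hR hex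
  exact ⟨f, hf, fun p => (hspec p).1⟩

end Representatives

/-! ### The uniform algorithms -/

section Main

theorem input_of_finite [Finite A] (ν : A → ℕ) (W : List (Word A)) :
    input ν W = (some (Nat.card A), W.map (codeWord ν)) := by
  rw [input, alphabetSize, if_pos ‹_›]

theorem input_of_infinite [Infinite A] (ν : A → ℕ) (W : List (Word A)) :
    input ν W = (none, W.map (codeWord ν)) := by
  rw [input, alphabetSize, if_neg (not_finite_iff_infinite.2 ‹_›)]

theorem computable_size : Computable fun i : Input => i.1.getD 0 :=
  Computable.option_getD Computable.fst (Computable.const 0)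

/-- A property is decidable for finitely generated subgroups if it fails for infinite alphabets and
is decided by an algorithm for finite ones. -/
theorem decidableForFG_of_finite {Q : (A : Type u) → Subgroup (FreeGroup A) → Prop}
    {P : ℕ → List (Word ℕ) → Prop}
    (hP : ComputablePred fun i : Input => P (i.1.getD 0) i.2)
    (hinf : ∀ (A : Type u) [Infinite A] (W : List (Word A)), ¬ Q A (gen W))
    (hfin : ∀ (A : Type u) (n : ℕ) (ν : A → ℕ) (W : List (Word A)), IsBijectiveNumbering ν n →
      (P n (W.map (codeWord ν)) ↔ Q A (gen W))) : DecidableForFG Q := by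
  -- For an infinite alphabet `P` is evaluated at the default size `0`, but the first conjunct
  -- already rejects.
  refine ⟨fun i => i.1.isSome = true ∧ P (i.1.getD 0) i.2, ComputablePred.and
    (ComputablePred.eq (Primrec.option_isSome.to_comp.comp Computable.fst) (Computable.const true))
    hP, fun A ν W hν => ?_⟩
  rcases finite_or_infinite A with _ | _
  · rw [input_of_finite]
    simpa using hfin A _ ν W hν.isBijectiveNumbering
  · rw [input_of_infinite]
    simpa using hinf A W

theorem decidableForFG_closure_fg : DecidableForFG.{u} fun _ H => (clAb H).FG := by
  refine decidableForFG_of_finite (computablePred_closureFG computable_size Computable.snd)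
    (fun A _ W => ?_) fun A n ν W h => ?_
  · rw [clAb_gen]
    exact not_fg_of_commutator_le le_sup_right
  · rw [h.closureFG_iff, clAb_gen]

theorem decidableForFG_isAbClosed : DecidableForFG.{u} fun _ H => IsAbClosed H := by
  refine decidableForFG_of_finite (computablePred_containsDerived computable_size Computable.snd)
    (fun A _ W => ?_) fun A n ν W h => ?_
  · rw [isAbClosed_iff (gen_fg W)]
    exact fun h => not_fg_of_commutator_le h (gen_fg W)
  · rw [h.containsDerived_iff, isAbClosed_iff (gen_fg W)]

theorem decidableForFG_isAbDense : DecidableForFG.{u} fun _ H => IsAbDense H := by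
  refine decidableForFG_of_finite
    (P := fun n W => ∀ a < n, FreeGroup.mk [(a, true)] ∈ gen W ⊔ commutator (FreeGroup ℕ)) ?_
    (fun A _ W => ?_) fun A n ν W h => ?_
  · exact ComputablePred.forall_lt (p := fun (i : Input) a =>
      FreeGroup.mk [(a, true)] ∈ gen i.2 ⊔ commutator (FreeGroup ℕ))
      (computablePred_mem_gen_sup_commutator (Computable.snd.comp Computable.fst)
        (Computable.list_cons.comp (Computable.snd.pair (Computable.const true))
          (Computable.const []))) computable_size
  · rw [isAbDense_iff, clAb_gen]
    exact sup_commutator_ne_top W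
  · rw [isAbDense_iff, clAb_gen, h.forall_iff]
    have hmem : ∀ a, FreeGroup.mk [(ν a, true)] ∈
        gen (W.map (codeWord ν)) ⊔ commutator (FreeGroup ℕ) ↔
          FreeGroup.of a ∈ gen W ⊔ commutator (FreeGroup A) := fun a =>
      mem_gen_sup_codeWord_iff (u := [(a, true)]) h.inj.injOn
    simp only [hmem]
    constructor
    · intro ha
      rw [eq_top_iff, ← FreeGroup.closure_range_of, Subgroup.closure_le]
      rintro _ ⟨a, rfl⟩
      exact ha a
    · intro htop a
      rw [htop]
      trivial

/-- The size of the alphabet is irrelevant: by decoding, membership may be tested in the free group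
on `ℕ`. -/
theorem membershipDecidableForFG_closure : MembershipDecidableForFG.{u} fun _ H => clAb H := by
  refine ⟨fun p => FreeGroup.mk p.2 ∈ gen p.1.2 ⊔ commutator (FreeGroup ℕ),
    computablePred_mem_gen_sup_commutator (Computable.snd.comp Computable.fst) Computable.snd,
    fun A ν W u hν => ?_⟩
  beta_reduce
  rw [clAb_gen]
  exact mem_gen_sup_codeWord_iff hν.injOn

theorem basisComputableForFG_closure : BasisComputableForFG.{u} fun _ H => clAb H := by
  obtain ⟨f, hf, hspec⟩ := exists_basis_bound
  refine ⟨fun i => basisList (i.1.getD 0) i.2 (f (i.1.getD 0, i.2)),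
    computable_basisList computable_size Computable.snd
      (hf.comp (computable_size.pair Computable.snd)), fun A ν W hν hfg => ?_⟩
  beta_reduce at hfg ⊢
  rw [clAb_gen] at hfg ⊢
  rcases finite_or_infinite A with _ | _
  · have h := hν.isBijectiveNumbering
    rw [input_of_finite]
    simp only [Option.getD_some]
    have hgen := hspec (Nat.card A, W.map (codeWord ν)) (fun w hw => by
      obtain ⟨v, -, rfl⟩ := List.mem_map.1 hw
      exact (h.lettersBelow_iff _).2 ⟨v, rfl⟩) ((h.closureFG_iff W).2 hfg)
    obtain ⟨r, hr, hS⟩ := exists_isSchreierRep h W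
    obtain ⟨L, hL, hnd, hsub⟩ := exists_basisList_eq h hr (f (Nat.card A, W.map (codeWord ν)))
    simp only at hgen
    rw [hL, h.generatesClosure_iff] at hgen
    -- The listed words are part of the Schreier basis and generate the closure, so they are the
    -- whole basis.
    refine ⟨L, hL, isBasisOf_list hS.isBasisOf hsub (le_antisymm ?_ hgen) hnd⟩
    refine (gen_le_iff _ _).2 fun w hw => ?_
    obtain ⟨a, t, -, -, rfl⟩ := hsub w hw
    exact hS.mk_edgeWord_mem a t
  · exact absurd hfg (not_fg_of_commutator_le le_sup_right)

theorem reBasisForFG_closure : REBasisForFG.{u} fun _ H => clAb H := by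
  refine ⟨fun i => basisWords (i.1.getD 0) i.2,
    fun p => (rewriteWord (minimalRep (p.1.1.getD 0) p.1.2) p.2).2,
    rePred_basisWords (computable_size.comp Computable.fst) (Computable.snd.comp Computable.fst)
      Computable.snd,
    Computable.snd.comp (computable_rewriteWord (computable_size.comp Computable.fst)
      (Computable.snd.comp Computable.fst) Computable.snd), fun A _ ν W hν => ?_⟩
  have h := hν.isBijectiveNumbering
  obtain ⟨r, hr, hS⟩ := exists_isSchreierRep h W
  beta_reduce
  rw [clAb_gen, input_of_finite]
  refine ⟨schreierWords r, basisWords_eq_image h hr, hS.isBasisOf, fun u hu =>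
    ⟨(rewriteWord r u).2, ?_, (hS.rewriteWord_spec u).2.1, hS.rewriteWord_eq hu⟩⟩
  simp only [Option.getD_some]
  rw [rewriteWord_codeWord h.inj hr]

end Main

end ProAb

theorem theorem4p3 :
    -- the closure is `H F_A'`
    (∀ (A : Type u) (H : Subgroup (FreeGroup A)), H.FG →
      (ProAb.clAb H : Set (FreeGroup A)) =
        (H : Set (FreeGroup A)) * (commutator (FreeGroup A) : Set (FreeGroup A))) ∧
    -- infinite alphabets
    (∀ (A : Type u) [Infinite A] (H : Subgroup (FreeGroup A)), H.FG → ¬ (ProAb.clAb H).FG) ∧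
    -- finite alphabets (the trivial subgroup of the infinite cyclic group is a genuine exception)
    (∀ (A : Type u) [Finite A] (H : Subgroup (FreeGroup A)), H.FG →
      ¬ (Nat.card A = 1 ∧ H = ⊥) →
      ((ProAb.clAb H).FG ↔ (ProAb.clAb H).FiniteIndex)) ∧
    -- finite generation of the closure is decidable
    ProAb.DecidableForFG.{u} (fun _ H => (ProAb.clAb H).FG) ∧
    -- a basis of the closure is computable if the closure is finitely generated
    ProAb.BasisComputableForFG.{u} (fun _ H => ProAb.clAb H) ∧
    -- **Ab**-closedness and **Ab**-density are decidable
    ProAb.DecidableForFG.{u} (fun _ H => ProAb.IsAbClosed H) ∧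
    ProAb.DecidableForFG.{u} (fun _ H => ProAb.IsAbDense H) ∧
    -- the membership problem for the closure is decidable
    ProAb.MembershipDecidableForFG.{u} (fun _ H => ProAb.clAb H) ∧
    -- recursively enumerable basis and expression algorithm for finite alphabets
    ProAb.REBasisForFG.{u} (fun _ H => ProAb.clAb H) := by
  refine ⟨fun A H hH => ?_, fun A _ H hH => ?_, fun A _ H hH hex => ?_,
    ProAb.decidableForFG_closure_fg, ProAb.basisComputableForFG_closure,
    ProAb.decidableForFG_isAbClosed, ProAb.decidableForFG_isAbDense,
    ProAb.membershipDecidableForFG_closure, ProAb.reBasisForFG_closure⟩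
  · rw [ProAb.clAb_eq_sup hH, Subgroup.mul_normal]
  · rw [ProAb.clAb_eq_sup hH]
    exact ProAb.not_fg_of_commutator_le le_sup_right
  · obtain ⟨W, rfl⟩ := ProAb.exists_gen_eq hH
    rw [ProAb.clAb_gen]
    exact ProAb.fg_iff_finiteIndex hex
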